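/- Let $d\ge 1$ and $n_1,\dots,n_d\ge 1$ be integers, and put $\Pi=n_1\cdots n_d$ and $n=1+\sum_{i=1}^d (n_i-1)$. Assume that $n_i<n$ for every $i$ with $n_i\ge 2$ (this is automatic if $d\ge 2$ and all $n_i\ge 2$). Let $\mathcal S=\{a_1\otimes\cdots\otimes a_d : 0\ne a_i\in\mathbb R^{n_i}\}\subset\mathbb R^{n_1\times\cdots\times n_d}\cong\mathbb R^\Pi$ be the manifold of rank-one tensors, and let $\mathbb P\mathcal S=\{[A]: A\in\mathcal S\}$ be its image in projective space. The Segre map $\sigma:\mathbb P(\mathbb R^{n_1})\times\cdots\times\mathbb P(\mathbb R^{n_d})\to\mathbb P\mathcal S$, $([a_1],\dots,[a_d])\mapsto[a_1\otimes\cdots\otimes a_d]$, is a diffeomorphism. Give $\mathbb P\mathcal S$ the weighted metric $g$, that is, the pull-back under $\sigma^{-1}$ of $$\langle u,v\rangle_{\mathrm w}=\sum_{i=1}^d (n-n_i)\,\langle u_i,v_i\rangle,\qquad u=(u_1,\dots,u_d),\ v=(v_1,\dots,v_d),$$ where $\langle\cdot,\cdot\rangle$ is the Fubini–Study metric on $\mathbb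 P(\mathbb R^{n_i})$ (the Euclidean inner product on $T_{[x]}\mathbb P(\mathbb R^{n_i})\cong x^\perp$, $\|x\|=1$). Give the Grassmann manifold $\mathrm{Gr}(\Pi,n)$ of $n$-dimensional linear subspaces of $\mathbb R^\Pi$ its standard metric $h$, that is, the inner product $\operatorname{trace}(u^{T}v)$ on $T_V\mathrm{Gr}(\Pi,n)\cong\mathrm{Hom}(V,V^\perp)$; its geodesic distance is $\sqrt{\theta_1^2+\cdots+\theta_n^2}$, where $\theta_1,\dots,\theta_n$ are the principal angles between two subspaces. For $A\in\mathcal S$ let $T_A\mathcal S\subset\mathbb R^\Pi$ be the tangent space of $\mathcal S$ at $A$, that is, the set of velocities $\gamma'(0)$ of smooth curves $\gamma$ in $\mathcal S$ with $\gamma(0)=A$. Then $T_A\mathcal S$ is a linear subspace of dimension $n$ that depends only on $[A]$, and the map $$\phi:\mathbb P\mathcal S\to\mathrm{Gr}(\Pi,n),\qquad [A]\mapsto T_A\mathcal S,$$ is an isometric immersion: $\phi$ is smooth, its differential $d\phi_p$ is injective for every $p\in\mathbb P\mathcal S$, and $g_p(u,v)=h_{\phi(p)}(d\phi_p u,d\phi_p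 v)$ for all $p\in\mathbb P\mathcal S$ and $u,v\in T_p\mathbb P\mathcal S$. -/

import Mathlib

open Module Set Topology
open scoped InnerProductSpace Manifold ContDiff

noncomputable section

/-! ### Isometric immersions -/

/-- A map `f : M → N` between manifolds carrying the metrics `g` and `h` (given pointwise as
forms on the tangent spaces) is an isometric immersion if it is smooth, all its differentials
are injective, and `g_p(u, v) = h_{f(p)}(df_p u, df_p v)` for all `p`, `u`, `v`. -/
structure IsIsometricImmersion
    {E : Type*} [NormedAddCommGroup E] [NormedSpace ℝ E] {H : Type*} [TopologicalSpace H]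
    (I : ModelWithCorners ℝ E H)
    {E' : Type*} [NormedAddCommGroup E'] [NormedSpace ℝ E'] {H' : Type*} [TopologicalSpace H']
    (I' : ModelWithCorners ℝ E' H')
    {M : Type*} [TopologicalSpace M] [ChartedSpace H M]
    {N : Type*} [TopologicalSpace N] [ChartedSpace H' N]
    (g : ∀ p : M, TangentSpace I p → TangentSpace I p → ℝ)
    (h : ∀ q : N, TangentSpace I' q → TangentSpace I' q → ℝ)
    (f : M → N) : Prop where
  smooth : ContMDiff I I' ∞ f
  immersion : ∀ p, Function.Injective (mfderiv I I' f p)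
  isometric : ∀ p (u v : TangentSpace I p),
    g p u v = h (f p) (mfderiv I I' f p u) (mfderiv I I' f p v)

/-! ### The Grassmann manifold -/

/-- The Grassmannian of `k`-dimensional linear subspaces of a Euclidean space `E`. -/
structure Gr (E : Type*) [NormedAddCommGroup E] [InnerProductSpace ℝ E] (k : ℕ) where
  toSubmodule : Submodule ℝ E
  finrank_eq : finrank ℝ toSubmodule = k

/-- The model space `Hom(ℝ^k, ℝ^(m-k))` of the Grassmannian, where `m = dim E`. -/
abbrev GrModel (E : Type*) [NormedAddCommGroup E] [InnerProductSpace ℝ E] (k : ℕ) : Type :=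
  EuclideanSpace ℝ (Fin k) →L[ℝ] EuclideanSpace ℝ (Fin (finrank ℝ E - k))

namespace Gr

variable {E : Type*} [NormedAddCommGroup E] [InnerProductSpace ℝ E] {k : ℕ}

theorem ext_submodule {V W : Gr E k} (h : V.toSubmodule = W.toSubmodule) : V = W := by
  cases V; cases W; cases h; rfl

variable [FiniteDimensional ℝ E]

theorem finrank_orthogonal_eq (V : Gr E k) :
    finrank ℝ V.toSubmoduleᗮ = finrank ℝ E - k := by
  have h := V.toSubmodule.finrank_add_finrank_orthogonal
  have h' := V.finrank_eq
  omega

/-- A linear isometry from `ℝ^k` onto `V`. -/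
def frame (V : Gr E k) : EuclideanSpace ℝ (Fin k) →L[ℝ] E :=
  V.toSubmodule.subtypeL ∘L
    (((stdOrthonormalBasis ℝ V.toSubmodule).reindex (finCongr V.finrank_eq)).repr.symm :
      EuclideanSpace ℝ (Fin k) →L[ℝ] V.toSubmodule)

/-- A linear isometry from `ℝ^(m-k)` onto the orthogonal complement of `V`. -/
def coframe (V : Gr E k) : EuclideanSpace ℝ (Fin (finrank ℝ E - k)) →L[ℝ] E :=
  V.toSubmoduleᗮ.subtypeL ∘L
    (((stdOrthonormalBasis ℝ V.toSubmoduleᗮ).reindex (finCongr V.finrank_orthogonal_eq)).repr.symm :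
      EuclideanSpace ℝ (Fin (finrank ℝ E - k)) →L[ℝ] V.toSubmoduleᗮ)

theorem range_frame (V : Gr E k) : V.frame.range = V.toSubmodule := by
  ext x
  constructor
  · rintro ⟨y, rfl⟩
    simp [frame]
  · intro hx
    refine ⟨((stdOrthonormalBasis ℝ V.toSubmodule).reindex
      (finCongr V.finrank_eq)).repr ⟨x, hx⟩, ?_⟩
    simp [frame]

theorem range_coframe (V : Gr E k) : V.coframe.range = V.toSubmoduleᗮ := by
  ext x
  constructor
  · rintro ⟨y, rfl⟩
    exact Subtype.property _
  · intro hx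
    refine ⟨((stdOrthonormalBasis ℝ V.toSubmoduleᗮ).reindex
      (finCongr V.finrank_orthogonal_eq)).repr ⟨x, hx⟩, ?_⟩
    simp [coframe]

theorem inner_frame (V : Gr E k) (x y : EuclideanSpace ℝ (Fin k)) :
    ⟪V.frame x, V.frame y⟫_ℝ = ⟪x, y⟫_ℝ := by
  simp only [frame, ContinuousLinearMap.comp_apply, Submodule.subtypeL_apply]
  rw [← Submodule.coe_inner]
  exact LinearIsometryEquiv.inner_map_map _ x y

theorem inner_coframe (V : Gr E k) (x y : EuclideanSpace ℝ (Fin (finrank ℝ E - k))) :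
    ⟪V.coframe x, V.coframe y⟫_ℝ = ⟪x, y⟫_ℝ := by
  simp only [coframe, ContinuousLinearMap.comp_apply, Submodule.subtypeL_apply]
  rw [← Submodule.coe_inner]
  exact LinearIsometryEquiv.inner_map_map _ x y

theorem inner_frame_coframe (V : Gr E k) (x : EuclideanSpace ℝ (Fin k))
    (y : EuclideanSpace ℝ (Fin (finrank ℝ E - k))) : ⟪V.frame x, V.coframe y⟫_ℝ = 0 := by
  refine Submodule.inner_right_of_mem_orthogonal (K := V.toSubmodule) ?_ ?_
  · rw [← V.range_frame]; exact ⟨x, rfl⟩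
  · rw [← V.range_coframe]; exact ⟨y, rfl⟩

/-- The component in `ℝ^k ≅ V` of a vector of `E`. -/
abbrev proj (V : Gr E k) : E →L[ℝ] EuclideanSpace ℝ (Fin k) :=
  ContinuousLinearMap.adjoint V.frame

/-- The component in `ℝ^(m-k) ≅ Vᗮ` of a vector of `E`. -/
abbrev coproj (V : Gr E k) : E →L[ℝ] EuclideanSpace ℝ (Fin (finrank ℝ E - k)) :=
  ContinuousLinearMap.adjoint V.coframe

theorem proj_frame (V : Gr E k) (x : EuclideanSpace ℝ (Fin k)) : V.proj (V.frame x) = x :=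
  ext_inner_right ℝ fun y => by
    rw [ContinuousLinearMap.adjoint_inner_left, inner_frame]

theorem coproj_coframe (V : Gr E k) (x : EuclideanSpace ℝ (Fin (finrank ℝ E - k))) :
    V.coproj (V.coframe x) = x :=
  ext_inner_right ℝ fun y => by
    rw [ContinuousLinearMap.adjoint_inner_left, inner_coframe]

theorem proj_coframe (V : Gr E k) (x : EuclideanSpace ℝ (Fin (finrank ℝ E - k))) :
    V.proj (V.coframe x) = 0 :=
  ext_inner_right ℝ fun y => by
    rw [ContinuousLinearMap.adjoint_inner_left, real_inner_comm, inner_frame_coframe,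
      inner_zero_left]

theorem coproj_frame (V : Gr E k) (x : EuclideanSpace ℝ (Fin k)) :
    V.coproj (V.frame x) = 0 :=
  ext_inner_right ℝ fun y => by
    rw [ContinuousLinearMap.adjoint_inner_left, inner_frame_coframe, inner_zero_left]

theorem frame_proj_add (V : Gr E k) (x : E) :
    V.frame (V.proj x) + V.coframe (V.coproj x) = x := by
  obtain ⟨y, hy, z, hz, rfl⟩ := V.toSubmodule.exists_add_mem_mem_orthogonal x
  rw [← V.range_frame] at hy
  rw [← V.range_coframe] at hz
  obtain ⟨a, rfl⟩ := hy
  obtain ⟨b, rfl⟩ := hz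
  simp only [ContinuousLinearMap.coe_coe, map_add, proj_frame, proj_coframe, coproj_frame,
    coproj_coframe, add_zero, zero_add]

theorem proj_eq_zero_iff (V : Gr E k) (x : E) : V.proj x = 0 ↔ x ∈ V.toSubmoduleᗮ := by
  constructor
  · intro h
    rw [← V.frame_proj_add x, h, map_zero, zero_add, ← V.range_coframe]
    exact ⟨_, rfl⟩
  · intro h
    rw [← V.range_coframe] at h
    obtain ⟨b, rfl⟩ := h
    exact V.proj_coframe b

theorem isUnit_iff_injective (T : EuclideanSpace ℝ (Fin k) →L[ℝ] EuclideanSpace ℝ (Fin k)) :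
    IsUnit T ↔ Function.Injective T := by
  rw [ContinuousLinearMap.isUnit_iff_bijective]
  refine ⟨fun h => h.1, fun h => ⟨h, ?_⟩⟩
  exact (LinearMap.injective_iff_surjective
    (f := (T : EuclideanSpace ℝ (Fin k) →ₗ[ℝ] EuclideanSpace ℝ (Fin k)))).1 h

theorem disjoint_iff_isUnit (V W : Gr E k) (w : EuclideanSpace ℝ (Fin k) →L[ℝ] E)
    (hw : Function.Injective w) (hr : w.range = W.toSubmodule) :
    Disjoint W.toSubmodule V.toSubmoduleᗮ ↔ IsUnit (V.proj ∘L w) := by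
  rw [isUnit_iff_injective, Submodule.disjoint_def]
  constructor
  · intro h
    refine (injective_iff_map_eq_zero _).2 fun x hx => ?_
    have : w x = 0 := h _ (hr ▸ ⟨x, rfl⟩) ((V.proj_eq_zero_iff _).1 hx)
    exact hw (by rw [this, map_zero])
  · intro h x hx hx'
    rw [← hr] at hx
    obtain ⟨y, rfl⟩ := hx
    have : y = 0 := h (by
      rw [map_zero]; exact (V.proj_eq_zero_iff _).2 hx')
    rw [this]; exact map_zero w

theorem frame_injective (V : Gr E k) : Function.Injective V.frame :=
  Function.LeftInverse.injective V.proj_frame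

/-- The graph map `x ↦ x + A x` of a linear map `A : V → Vᗮ`. -/
def graphMap (V : Gr E k) (A : GrModel E k) : EuclideanSpace ℝ (Fin k) →L[ℝ] E :=
  V.frame + V.coframe ∘L A

theorem proj_graphMap (V : Gr E k) (A : GrModel E k) (x : EuclideanSpace ℝ (Fin k)) :
    V.proj (V.graphMap A x) = x := by
  simp [graphMap, proj_frame, proj_coframe]

theorem coproj_graphMap (V : Gr E k) (A : GrModel E k) (x : EuclideanSpace ℝ (Fin k)) :
    V.coproj (V.graphMap A x) = A x := by
  simp [graphMap, coproj_frame, coproj_coframe]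

theorem graphMap_injective (V : Gr E k) (A : GrModel E k) :
    Function.Injective (V.graphMap A) :=
  Function.LeftInverse.injective (V.proj_graphMap A)

/-- The graph `{x + A x | x ∈ V}` of a linear map `A : V → Vᗮ`. -/
def graph (V : Gr E k) (A : GrModel E k) : Gr E k where
  toSubmodule := (V.graphMap A).range
  finrank_eq := by
    have h := LinearMap.finrank_range_of_inj
      (f := (V.graphMap A : EuclideanSpace ℝ (Fin k) →ₗ[ℝ] E)) (V.graphMap_injective A)
    simpa using h

/-- The slope over `V` of the subspace spanned by the columns of `w`: if `w` is injective with
range transversal to `Vᗮ`, this is the linear map `A : V → Vᗮ` whose graph is the range. -/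
def slope (V : Gr E k) (w : EuclideanSpace ℝ (Fin k) →L[ℝ] E) : GrModel E k :=
  (V.coproj ∘L w) ∘L Ring.inverse (V.proj ∘L w)

theorem graphMap_slope (V : Gr E k) (w : EuclideanSpace ℝ (Fin k) →L[ℝ] E)
    (h : IsUnit (V.proj ∘L w)) : V.graphMap (V.slope w) ∘L (V.proj ∘L w) = w := by
  have h1 : Ring.inverse (V.proj ∘L w) * (V.proj ∘L w) = 1 := Ring.inverse_mul_cancel _ h
  ext1 x
  have h2 : Ring.inverse (V.proj ∘L w) (V.proj (w x)) = x := by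
    simpa using DFunLike.congr_fun h1 x
  simp only [graphMap, slope, ContinuousLinearMap.comp_apply, _root_.add_apply, h2]
  exact V.frame_proj_add (w x)

theorem graph_slope (V W : Gr E k) (w : EuclideanSpace ℝ (Fin k) →L[ℝ] E)
    (hr : w.range = W.toSubmodule) (h : IsUnit (V.proj ∘L w)) : V.graph (V.slope w) = W := by
  apply ext_submodule
  rw [← hr]
  have hs := ((ContinuousLinearMap.isUnit_iff_bijective).1 h).2
  have hg := V.graphMap_slope w h
  ext x
  constructor
  · rintro ⟨y, rfl⟩
    obtain ⟨z, rfl⟩ := hs y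
    exact ⟨z, (DFunLike.congr_fun hg z).symm⟩
  · rintro ⟨z, rfl⟩
    exact ⟨(V.proj ∘L w) z, DFunLike.congr_fun hg z⟩

theorem slope_of_range_eq (V : Gr E k) (A : GrModel E k)
    (w : EuclideanSpace ℝ (Fin k) →L[ℝ] E) (hw : Function.Injective w)
    (hr : w.range = (V.graph A).toSubmodule) :
    IsUnit (V.proj ∘L w) ∧ V.slope w = A := by
  have key : ∀ x, V.graphMap A (V.proj (w x)) = w x := by
    intro x
    have : w x ∈ (V.graphMap A).range := by
      change w x ∈ (V.graph A).toSubmodule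
      rw [← hr]; exact ⟨x, rfl⟩
    obtain ⟨y, hy⟩ := this
    have hy' : V.graphMap A y = w x := hy
    rw [← hy', proj_graphMap]
  have hu : IsUnit (V.proj ∘L w) := by
    rw [isUnit_iff_injective]
    refine (injective_iff_map_eq_zero _).2 fun x hx => hw ?_
    rw [← key x, show V.proj (w x) = 0 from hx, map_zero, map_zero]
  refine ⟨hu, ?_⟩
  have h1 : (V.proj ∘L w) * Ring.inverse (V.proj ∘L w) = 1 := Ring.mul_inverse_cancel _ hu
  ext1 x
  have h2 : V.proj (w (Ring.inverse (V.proj ∘L w) x)) = x := by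
    simpa using DFunLike.congr_fun h1 x
  simp only [slope, ContinuousLinearMap.comp_apply]
  rw [← key, coproj_graphMap, h2]

/-- The standard chart of the Grassmannian at `V`: a subspace `W` transversal to `Vᗮ` is the graph
of a unique linear map `V → Vᗮ`, which is written as a map `ℝ^k → ℝ^(m-k)` in orthonormal bases
of `V` and `Vᗮ`. -/
def chart (V : Gr E k) : PartialEquiv (Gr E k) (GrModel E k) where
  toFun W := V.slope W.frame
  invFun A := V.graph A
  source := {W | Disjoint W.toSubmodule V.toSubmoduleᗮ}
  target := univ
  map_source' _ _ := mem_univ _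
  map_target' A _ := by
    have h := V.slope_of_range_eq A _ (V.graph A).frame_injective (V.graph A).range_frame
    exact (V.disjoint_iff_isUnit _ _ (V.graph A).frame_injective (V.graph A).range_frame).2 h.1
  left_inv' W hW := V.graph_slope W _ W.range_frame
    ((V.disjoint_iff_isUnit W _ W.frame_injective W.range_frame).1 hW)
  right_inv' A _ :=
    (V.slope_of_range_eq A _ (V.graph A).frame_injective (V.graph A).range_frame).2

theorem mem_chart_source (V : Gr E k) : V ∈ V.chart.source :=
  V.toSubmodule.orthogonal_disjoint

theorem chart_symm_trans_source (V V' : Gr E k) :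
    (V.chart.symm.trans V'.chart).source = {A | IsUnit (V'.proj ∘L V.graphMap A)} := by
  ext A
  simp only [PartialEquiv.trans_source, PartialEquiv.symm_source, mem_inter_iff, mem_preimage,
    mem_ofPred_eq]
  rw [← V'.disjoint_iff_isUnit (V.graph A) (V.graphMap A) (V.graphMap_injective A) rfl]
  simp [chart]

theorem chart_symm_trans_apply (V V' : Gr E k) (A : GrModel E k)
    (h : IsUnit (V'.proj ∘L V.graphMap A)) :
    V.chart.symm.trans V'.chart A = V'.slope (V.graphMap A) := by
  have h1 := V'.graph_slope (V.graph A) (V.graphMap A) rfl h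
  have h2 := (V'.slope_of_range_eq (V'.slope (V.graphMap A)) _ (V.graph A).frame_injective
    (by rw [h1, range_frame])).2
  exact h2

theorem contDiff_graphMap (V : Gr E k) : ContDiff ℝ ∞ V.graphMap := by
  unfold graphMap
  exact contDiff_const.add (contDiff_const.clm_comp contDiff_id)

theorem isOpen_chart_symm_trans_source (V V' : Gr E k) :
    IsOpen (V.chart.symm.trans V'.chart).source := by
  rw [chart_symm_trans_source]
  exact Units.isOpen.preimage
    ((contDiff_const (c := V'.proj)).clm_comp V.contDiff_graphMap).continuous

theorem contDiffOn_chart_symm_trans (V V' : Gr E k) :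
    ContDiffOn ℝ ∞ (V.chart.symm.trans V'.chart) (V.chart.symm.trans V'.chart).source := by
  rw [chart_symm_trans_source]
  refine ContDiffOn.congr (f := fun A => V'.slope (V.graphMap A)) ?_
    (fun A hA => V.chart_symm_trans_apply V' A hA)
  intro A hA
  refine ContDiffAt.contDiffWithinAt ?_
  have h1 : ContDiff ℝ ∞ fun A => V'.proj ∘L V.graphMap A :=
    contDiff_const.clm_comp V.contDiff_graphMap
  have h2 : ContDiff ℝ ∞ fun A => V'.coproj ∘L V.graphMap A :=
    contDiff_const.clm_comp V.contDiff_graphMap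
  obtain ⟨u, hu⟩ := hA
  have h3 : ContDiffAt ℝ ∞ Ring.inverse (V'.proj ∘L V.graphMap A) := by
    rw [← hu]; exact contDiffAt_ringInverse ℝ u
  exact h2.contDiffAt.clm_comp (ContDiffAt.comp A (g := Ring.inverse) h3 h1.contDiffAt)

variable (E k) in
/-- The standard atlas of the Grassmannian. -/
def core : ChartedSpaceCore (GrModel E k) (Gr E k) where
  atlas := range chart
  chartAt := chart
  mem_chart_source := mem_chart_source
  chart_mem_atlas V := mem_range_self V
  open_source := by
    rintro _ _ ⟨V, rfl⟩ ⟨V', rfl⟩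
    exact V.isOpen_chart_symm_trans_source V'
  continuousOn_toFun := by
    rintro _ _ ⟨V, rfl⟩ ⟨V', rfl⟩
    exact (V.contDiffOn_chart_symm_trans V').continuousOn

instance : TopologicalSpace (Gr E k) := (core E k).toTopologicalSpace

instance : ChartedSpace (GrModel E k) (Gr E k) := (core E k).toChartedSpace

/-- The Grassmannian is a smooth manifold. -/
instance : IsManifold 𝓘(ℝ, GrModel E k) ∞ (Gr E k) := by
  refine isManifold_of_contDiffOn _ _ _ ?_
  intro e e' he he'
  obtain ⟨c, hc, he⟩ := mem_iUnion₂.1 he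
  obtain ⟨c', hc', he'⟩ := mem_iUnion₂.1 he'
  obtain ⟨V, rfl⟩ := hc
  obtain ⟨V', rfl⟩ := hc'
  rw [mem_singleton_iff] at he he'
  subst he he'
  have h := V.contDiffOn_chart_symm_trans V'
  simp only [modelWithCornersSelf_coe, modelWithCornersSelf_coe_symm, Function.id_comp,
    Function.comp_id, preimage_id, range_id, inter_univ]
  exact h

/-- A tangent vector at `V`, read in the chart centred at `V`, is a linear map `V → Vᗮ`, written
as a map `ℝ^k → ℝ^(m-k)` in orthonormal bases of `V` and `Vᗮ`. -/
def toHom (V : Gr E k) (u : TangentSpace 𝓘(ℝ, GrModel E k) V) : GrModel E k := u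

/-- The standard Riemannian metric of the Grassmannian: on `T_V Gr = Hom(V, Vᗮ)` it is the
Hilbert-Schmidt inner product `⟨u, v⟩ = trace (uᵀ v)`. With this scaling the geodesic distance is
`(θ_1² + ⋯ + θ_k²)^(1/2)`, where the `θ_i` are the principal angles. -/
def standardMetric (V : Gr E k) (u v : TangentSpace 𝓘(ℝ, GrModel E k) V) : ℝ :=
  LinearMap.trace ℝ (EuclideanSpace ℝ (Fin k))
    (ContinuousLinearMap.adjoint (V.toHom u) ∘L V.toHom v)

end Gr

/-! ### Projective space -/

/-- The projective space of a Euclidean space `E`: the manifold of lines through the origin. -/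
abbrev ProjSpace (E : Type*) [NormedAddCommGroup E] [InnerProductSpace ℝ E] : Type _ := Gr E 1

namespace ProjSpace

variable {E : Type*} [NormedAddCommGroup E] [InnerProductSpace ℝ E]

/-- The point `[x]` of projective space represented by a nonzero vector `x`. -/
def mk (x : E) (hx : x ≠ 0) : ProjSpace E where
  toSubmodule := ℝ ∙ x
  finrank_eq := finrank_span_singleton hx

theorem mk_eq_mk_iff (x y : E) (hx : x ≠ 0) (hy : y ≠ 0) :
    mk x hx = mk y hy ↔ ∃ c : ℝ, x = c • y := by
  constructor
  · intro h
    have h1 : x ∈ (mk y hy).toSubmodule := h ▸ Submodule.mem_span_singleton_self x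
    obtain ⟨c, hc⟩ := Submodule.mem_span_singleton.1 h1
    exact ⟨c, hc.symm⟩
  · rintro ⟨c, rfl⟩
    have hc : c ≠ 0 := fun h => hx (by rw [h, zero_smul])
    exact Gr.ext_submodule (Submodule.span_singleton_smul_eq (IsUnit.mk0 c hc) y)

variable [FiniteDimensional ℝ E]

/-- A unit vector on the line `L`. -/
def rep (L : ProjSpace E) : E := L.frame (EuclideanSpace.single 0 1)

/-- The Fubini-Study metric. A tangent vector `u` at the line `L` is a linear map `L → Lᗮ`;
evaluating it at the unit vector `rep L` identifies the tangent space with `Lᗮ`, and the metric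
is the Euclidean inner product of `Lᗮ`. -/
def fubiniStudy (L : ProjSpace E) (u v : TangentSpace 𝓘(ℝ, GrModel E 1) L) : ℝ :=
  ⟪L.toHom u (EuclideanSpace.single 0 1), L.toHom v (EuclideanSpace.single 0 1)⟫_ℝ

theorem rep_ne_zero (L : ProjSpace E) : L.rep ≠ 0 := by
  intro h
  have h' : (EuclideanSpace.single 0 1 : EuclideanSpace ℝ (Fin 1)) = 0 :=
    L.frame_injective (by rw [map_zero]; exact h)
  simp at h'

theorem mk_eq_of_mem (L : ProjSpace E) (x : E) (hx : x ≠ 0) (h : x ∈ L.toSubmodule) :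
    mk x hx = L := by
  apply Gr.ext_submodule
  refine Submodule.eq_of_le_of_finrank_eq ?_ ?_
  · exact (Submodule.span_singleton_le_iff_mem _ _).2 h
  · rw [L.finrank_eq]; exact finrank_span_singleton hx

theorem mk_rep (L : ProjSpace E) : mk L.rep L.rep_ne_zero = L :=
  mk_eq_of_mem L _ _ (by rw [← L.range_frame]; exact ⟨_, rfl⟩)

end ProjSpace

/-! ### Rank-one tensors and the Segre manifold -/

section Segre

variable {d : ℕ}

/-- The space of real `n_1 × ⋯ × n_d` tensors with its Euclidean structure. -/
abbrev Tensor (n : Fin d → ℕ) : Type := EuclideanSpace ℝ (∀ i, Fin (n i))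

/-- The tensor product `a_1 ⊗ ⋯ ⊗ a_d`, with entries `a_1(k_1) ⋯ a_d(k_d)`. -/
def tensorProd {n : Fin d → ℕ} (a : ∀ i, EuclideanSpace ℝ (Fin (n i))) : Tensor n :=
  WithLp.toLp 2 fun k => ∏ i, a i (k i)

/-- The Segre manifold `S` of rank-one tensors. -/
def segre (n : Fin d → ℕ) : Set (Tensor n) :=
  {A | ∃ a : ∀ i, EuclideanSpace ℝ (Fin (n i)), (∀ i, a i ≠ 0) ∧ A = tensorProd a}

/-- The number `1 + ∑ (n_i - 1)`, the dimension of the Segre manifold when all `n_i ≥ 1`. -/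
def segreDim (n : Fin d → ℕ) : ℕ := 1 + ∑ i, (n i - 1)

/-- The tangent vectors at `A` of a subset `S` of a Euclidean space: the velocities `γ'(0)` of the
smooth curves `γ : (-ε, ε) → S` with `γ(0) = A`. If `S` is an embedded submanifold, this is its
tangent space at `A`, as a linear subspace of the ambient space. -/
def tangentVectors {E : Type*} [NormedAddCommGroup E] [NormedSpace ℝ E] (S : Set E) (A : E) :
    Set E :=
  {v | ∃ ε > 0, ∃ γ : ℝ → E, ContDiffOn ℝ ∞ γ (Ioo (-ε) ε) ∧ (∀ t ∈ Ioo (-ε) ε, γ t ∈ S) ∧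
    γ 0 = A ∧ HasDerivAt γ v 0}

theorem exists_coord_ne_zero {m : ℕ} {x : EuclideanSpace ℝ (Fin m)} (hx : x ≠ 0) :
    ∃ k, x k ≠ 0 := by
  by_contra! h
  exact hx (by ext k; exact h k)

theorem tensorProd_ne_zero {n : Fin d → ℕ} {a : ∀ i, EuclideanSpace ℝ (Fin (n i))}
    (ha : ∀ i, a i ≠ 0) : tensorProd a ≠ 0 := by
  choose k hk using fun i => exists_coord_ne_zero (ha i)
  intro h
  have h' : ∏ i, a i (k i) = 0 := congrArg (fun A : Tensor n => A k) h
  exact Finset.prod_ne_zero_iff.2 (fun i _ => hk i) h'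

theorem ne_zero_of_mem_segre {n : Fin d → ℕ} {A : Tensor n} (hA : A ∈ segre n) : A ≠ 0 := by
  obtain ⟨a, ha, rfl⟩ := hA
  exact tensorProd_ne_zero ha

/-- The factors of a rank-one tensor are determined up to scalars. -/
theorem exists_smul_of_tensorProd_eq {n : Fin d → ℕ} {a b : ∀ i, EuclideanSpace ℝ (Fin (n i))}
    (ha : ∀ i, a i ≠ 0) (c : ℝ) (h : tensorProd a = c • tensorProd b) (i : Fin d) :
    ∃ r : ℝ, a i = r • b i := by
  choose k hk using fun i => exists_coord_ne_zero (ha i)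
  set P := ∏ j ∈ Finset.univ.erase i, a j (k j) with hP
  set Q := ∏ j ∈ Finset.univ.erase i, b j (k j) with hQ
  have hP0 : P ≠ 0 := Finset.prod_ne_zero_iff.2 fun j _ => hk j
  refine ⟨c * Q / P, ?_⟩
  ext x
  have hx : tensorProd a (Function.update k i x) = c * tensorProd b (Function.update k i x) := by
    rw [h]; rfl
  have split : ∀ e : ∀ i, EuclideanSpace ℝ (Fin (n i)),
      tensorProd e (Function.update k i x) = e i x * ∏ j ∈ Finset.univ.erase i, e j (k j) := by
    intro e
    change ∏ j, e j (Function.update k i x j) = _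
    rw [← Finset.mul_prod_erase Finset.univ _ (Finset.mem_univ i), Function.update_self]
    congr 1
    refine Finset.prod_congr rfl fun j hj => ?_
    rw [Function.update_of_ne (Finset.ne_of_mem_erase hj)]
  rw [split, split, ← hP, ← hQ] at hx
  change a i x = c * Q / P * b i x
  field_simp
  linarith

theorem tensorProd_smul {n : Fin d → ℕ} (r : Fin d → ℝ) (a : ∀ i, EuclideanSpace ℝ (Fin (n i))) :
    tensorProd (fun i => r i • a i) = (∏ i, r i) • tensorProd a := by
  ext k
  change ∏ i, r i * a i (k i) = (∏ i, r i) * ∏ i, a i (k i)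
  exact Finset.prod_mul_distrib

/-- The projectivization `ℙS` of the Segre manifold: the set of classes `[A]` of rank-one
tensors `A`. -/
structure ProjSegre (n : Fin d → ℕ) where
  toLine : ProjSpace (Tensor n)
  exists_eq_mk : ∃ (A : Tensor n) (hA : A ∈ segre n),
    toLine = ProjSpace.mk A (ne_zero_of_mem_segre hA)

/-- The class `[A]` of a rank-one tensor `A`. -/
def ProjSegre.ofTensor {n : Fin d → ℕ} (A : Tensor n) (hA : A ∈ segre n) : ProjSegre n :=
  ⟨ProjSpace.mk A (ne_zero_of_mem_segre hA), A, hA, rfl⟩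

/-- The product of projective spaces `ℙ(ℝ^{n_1}) × ⋯ × ℙ(ℝ^{n_d})`, with the product manifold
structure. -/
abbrev ProjProd (n : Fin d → ℕ) : Type :=
  ∀ i, ProjSpace (EuclideanSpace ℝ (Fin (n i)))

/-- The projective Segre map `([a_1], …, [a_d]) ↦ [a_1 ⊗ ⋯ ⊗ a_d]`. -/
def segreMap (n : Fin d → ℕ) (p : ProjProd n) : ProjSegre n :=
  ProjSegre.ofTensor (tensorProd fun i => (p i).rep)
    ⟨fun i => (p i).rep, fun i => (p i).rep_ne_zero, rfl⟩

theorem segreMap_mk {n : Fin d → ℕ} (a : ∀ i, EuclideanSpace ℝ (Fin (n i))) (ha : ∀ i, a i ≠ 0) :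
    segreMap n (fun i => ProjSpace.mk (a i) (ha i)) =
      ProjSegre.ofTensor (tensorProd a) ⟨a, ha, rfl⟩ := by
  have h := fun i => (ProjSpace.mk_eq_mk_iff _ _ _ _).1 (ProjSpace.mk_rep (ProjSpace.mk (a i) (ha i)))
  choose r hr using h
  unfold segreMap ProjSegre.ofTensor
  congr 1
  refine (ProjSpace.mk_eq_mk_iff _ _ _ _).2 ⟨∏ i, r i, ?_⟩
  rw [← tensorProd_smul]
  exact congrArg tensorProd (funext hr)

theorem segreMap_bijective (n : Fin d → ℕ) : Function.Bijective (segreMap n) := by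
  constructor
  · intro p q h
    have h' : (segreMap n p).toLine = (segreMap n q).toLine := by rw [h]
    obtain ⟨c, hc⟩ := (ProjSpace.mk_eq_mk_iff _ _
      (tensorProd_ne_zero fun i => (p i).rep_ne_zero)
      (tensorProd_ne_zero fun i => (q i).rep_ne_zero)).1 h'
    funext i
    rw [← (p i).mk_rep, ← (q i).mk_rep]
    exact (ProjSpace.mk_eq_mk_iff _ _ _ _).2
      (exists_smul_of_tensorProd_eq (fun i => (p i).rep_ne_zero) c hc i)
  · rintro ⟨L, A, ⟨a, ha, rfl⟩, rfl⟩
    exact ⟨_, segreMap_mk a ha⟩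

/-- The projective Segre map as a bijection onto `ℙS`. -/
def segreEquiv (n : Fin d → ℕ) : ProjProd n ≃ ProjSegre n :=
  Equiv.ofBijective (segreMap n) (segreMap_bijective n)

/-- The model with corners (without boundary) of the product of projective spaces. -/
abbrev segreModel (n : Fin d → ℕ) :
    ModelWithCorners ℝ (∀ i, GrModel (EuclideanSpace ℝ (Fin (n i))) 1)
      (ModelPi fun i => GrModel (EuclideanSpace ℝ (Fin (n i))) 1) :=
  ModelWithCorners.pi fun i => 𝓘(ℝ, GrModel (EuclideanSpace ℝ (Fin (n i))) 1)

/-- `ℙS` carries the manifold structure for which the projective Segre map is a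
diffeomorphism. -/
instance (n : Fin d → ℕ) : TopologicalSpace (ProjSegre n) :=
  TopologicalSpace.induced (segreEquiv n).symm inferInstance

/-- The inverse of the projective Segre map is a homeomorphism. -/
def segreHomeomorph (n : Fin d → ℕ) : ProjSegre n ≃ₜ ProjProd n :=
  (segreEquiv n).symm.toHomeomorphOfIsInducing ⟨rfl⟩

instance (n : Fin d → ℕ) :
    ChartedSpace (ModelPi fun i => GrModel (EuclideanSpace ℝ (Fin (n i))) 1) (ProjSegre n) where
  atlas := (fun e => (segreHomeomorph n).toOpenPartialHomeomorph ≫ₕ e) '' atlas _ (ProjProd n)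
  chartAt p := (segreHomeomorph n).toOpenPartialHomeomorph ≫ₕ chartAt _ (segreHomeomorph n p)
  mem_chart_source p := by simp
  chart_mem_atlas p := mem_image_of_mem _ (chart_mem_atlas _ _)

/-- The projectivized Segre manifold is a smooth manifold. -/
instance (n : Fin d → ℕ) : IsManifold (segreModel n) ∞ (ProjSegre n) := by
  refine isManifold_of_contDiffOn _ _ _ ?_
  rintro _ _ ⟨_, ⟨a, ha, rfl⟩, rfl⟩ ⟨_, ⟨b, hb, rfl⟩, rfl⟩
  refine contDiffOn_pi.2 fun i => ?_
  have hc : (a i).symm ≫ₕ b i ∈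
      contDiffGroupoid ∞ 𝓘(ℝ, GrModel (EuclideanSpace ℝ (Fin (n i))) 1) :=
    HasGroupoid.compatible (ha i (mem_univ i)) (hb i (mem_univ i))
  have h : ContDiffOn ℝ ∞ ((a i).symm ≫ₕ b i) ((a i).symm ≫ₕ b i).source := by
    have h' := (mem_groupoid_of_pregroupoid.1 hc).1
    simp only [contDiffPregroupoid, modelWithCornersSelf_coe, modelWithCornersSelf_coe_symm,
      Function.id_comp, Function.comp_id, preimage_id, range_id, inter_univ] at h'
    exact h'
  have hσ : ∀ y, segreHomeomorph n ((segreHomeomorph n).symm y) = y :=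
    (segreHomeomorph n).apply_symm_apply
  refine (h.comp (ContinuousLinearMap.proj (R := ℝ)
    (φ := fun i => GrModel (EuclideanSpace ℝ (Fin (n i))) 1) i).contDiff.contDiffOn ?_).congr ?_
  · rintro x ⟨⟨hx, hx'⟩, -⟩
    refine ⟨hx.1 i (mem_univ i), ?_⟩
    have hx2 := hx'.2 i (mem_univ i)
    change segreHomeomorph n ((segreHomeomorph n).symm _) i ∈ (b i).source at hx2
    rw [hσ] at hx2
    exact hx2
  · rintro x -
    change b i (segreHomeomorph n ((segreHomeomorph n).symm _) i) = _
    rw [hσ]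
    rfl

/-- The weighted metric on `ℙ(ℝ^{n_1}) × ⋯ × ℙ(ℝ^{n_d})`: the sum of the Fubini-Study metrics of
the factors with the weights `n - n_i`, where `n` is the dimension of the Segre manifold. -/
def weightedProdMetric (n : Fin d → ℕ) (p : ProjProd n)
    (u v : TangentSpace (segreModel n) p) : ℝ :=
  ∑ i, ((segreDim n : ℝ) - n i) *
    (p i).fubiniStudy ((u : ∀ i, GrModel (EuclideanSpace ℝ (Fin (n i))) 1) i)
      ((v : ∀ i, GrModel (EuclideanSpace ℝ (Fin (n i))) 1) i)

/-- The weighted metric on `ℙS`: the pull-back of the weighted metric of the product of projective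
spaces under the inverse of the projective Segre map. -/
def weightedMetric (n : Fin d → ℕ) (p : ProjSegre n) (u v : TangentSpace (segreModel n) p) : ℝ :=
  weightedProdMetric n ((segreEquiv n).symm p)
    (mfderiv (segreModel n) (segreModel n) (segreEquiv n).symm p u)
    (mfderiv (segreModel n) (segreModel n) (segreEquiv n).symm p v)

end Segre

end

/-! Choose unit vectors `a_i` on the given lines. The tangent space at `a_1 ⊗ ⋯ ⊗ a_d` has an
orthonormal basis made of this tensor and of the tensors in which a single `a_i` is replaced by a
member `b` of an orthonormal basis of its orthogonal complement (`orthonormal_segreFrame`,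
`span_segreFrame`).

A displacement of the lines in directions `u_j` is realised by shears `id + N_j`, where `N_j` sends
`a_j` to `u_j` and kills the complement of `a_j`. The tensor product of the shears carries the old
tangent space into the new one. This gives smooth frames, and shows that the differential of the map
to the Grassmannian is the normal part of the derivation which applies `N_j` in slot `j` and sums
over `j` (`toHom_mfderiv_segreGauss`).

On `a_1 ⊗ ⋯ ⊗ a_d` this derivation is tangent and contributes nothing. On the basis tensor with `b`
in slot `i`, slot `i` gives zero, and every slot `j ≠ i` gives a tensor containing both `b` and
`u_j`. These tensors are normal and mutually orthogonal, so the image has squared norm `∑_{j ≠ i}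
|u_j|²`. Slot `i` offers `n_i - 1` choices of `b`; hence `|u_j|²` is counted `∑_{i ≠ j} (n_i - 1) =
n - n_j` times, which is the weight (`standardMetric_mfderiv_segreGauss`). Injectivity of the
differential follows from the isometry: the weights are positive except possibly at factors that are
points.

That the algebraic tangent space consists of all velocities of curves rests on a polynomial identity
recovering a rank-one tensor from its fibres (`pow_smul_eq_of_mem_segre`). -/

noncomputable section

/-! ### Tensor products as multilinear maps, and the algebraic tangent space. -/

section Multilinear

variable {d : ℕ} {n : Fin d → ℕ}

theorem tensorProd_apply (a : ∀ i, EuclideanSpace ℝ (Fin (n i))) (k : ∀ i, Fin (n i)) :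
    tensorProd a k = ∏ i, a i (k i) := rfl

theorem tensorProd_update_apply (a : ∀ i, EuclideanSpace ℝ (Fin (n i))) (i : Fin d)
    (x : EuclideanSpace ℝ (Fin (n i))) (k : ∀ i, Fin (n i)) :
    tensorProd (Function.update a i x) k = x (k i) * ∏ j ∈ Finset.univ.erase i, a j (k j) := by
  rw [tensorProd_apply, ← Finset.mul_prod_erase Finset.univ _ (Finset.mem_univ i),
    Function.update_self]
  congr 1
  refine Finset.prod_congr rfl fun j hj => ?_
  rw [Function.update_of_ne (Finset.ne_of_mem_erase hj)]

variable (n) in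
/-- The tensor product as a continuous multilinear map. -/
def tensorProdL : ContinuousMultilinearMap ℝ (fun i => EuclideanSpace ℝ (Fin (n i))) (Tensor n) where
  toFun := tensorProd
  map_update_add' := by
    intro inst a i x y
    obtain rfl : inst = instDecidableEqFin d := Subsingleton.elim _ _
    ext k
    simp only [PiLp.add_apply, tensorProd_update_apply, add_mul]
  map_update_smul' := by
    intro inst a i c x
    obtain rfl : inst = instDecidableEqFin d := Subsingleton.elim _ _
    ext k
    simp only [PiLp.smul_apply, smul_eq_mul, tensorProd_update_apply, mul_assoc]
  cont := by
    refine (PiLp.continuous_toLp 2 _).comp (continuous_pi fun k => ?_)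
    fun_prop

theorem inner_tensorProd (a b : ∀ i, EuclideanSpace ℝ (Fin (n i))) :
    ⟪tensorProd a, tensorProd b⟫_ℝ = ∏ i, ⟪a i, b i⟫_ℝ := by
  simp only [PiLp.inner_apply, tensorProd_apply, RCLike.inner_apply, conj_trivial]
  rw [Finset.prod_univ_sum, Fintype.piFinset_univ]
  exact Finset.sum_congr rfl fun k _ => Finset.prod_mul_distrib.symm

/-- The tangent space of the Segre manifold at `a_1 ⊗ ⋯ ⊗ a_d`: the space of all sums
`∑ i, a_1 ⊗ ⋯ ⊗ y_i ⊗ ⋯ ⊗ a_d`. -/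
def segreTangent (a : ∀ i, EuclideanSpace ℝ (Fin (n i))) : Submodule ℝ (Tensor n) :=
  ((tensorProdL n).linearDeriv a).range

theorem linearDeriv_tensorProdL (a y : ∀ i, EuclideanSpace ℝ (Fin (n i))) :
    (tensorProdL n).linearDeriv a y = ∑ i, tensorProd (Function.update a i (y i)) :=
  ContinuousMultilinearMap.linearDeriv_apply _ _ _

theorem update_mem_segreTangent (a : ∀ i, EuclideanSpace ℝ (Fin (n i))) (i : Fin d)
    (x : EuclideanSpace ℝ (Fin (n i))) :
    tensorProd (Function.update a i x) ∈ segreTangent a := by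
  refine ⟨Pi.single i x, ?_⟩
  change (tensorProdL n).linearDeriv a (Pi.single i x) = _
  rw [linearDeriv_tensorProdL, Finset.sum_eq_single i]
  · rw [Pi.single_eq_same]
  · intro j _ hj
    rw [Pi.single_eq_of_ne hj]
    exact (tensorProdL n).map_update_zero a j
  · simp

theorem segreTangent_le_iff (a : ∀ i, EuclideanSpace ℝ (Fin (n i))) (W : Submodule ℝ (Tensor n)) :
    segreTangent a ≤ W ↔ ∀ i x, tensorProd (Function.update a i x) ∈ W := by
  constructor
  · exact fun h i x => h (update_mem_segreTangent a i x)
  · rintro h _ ⟨y, rfl⟩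
    change (tensorProdL n).linearDeriv a y ∈ W
    rw [linearDeriv_tensorProdL]
    exact W.sum_mem fun i _ => h i (y i)

theorem tensorProd_mem_segreTangent (hd : 1 ≤ d) (a : ∀ i, EuclideanSpace ℝ (Fin (n i))) :
    tensorProd a ∈ segreTangent a := by
  have h := update_mem_segreTangent a ⟨0, hd⟩ (a ⟨0, hd⟩)
  rwa [Function.update_eq_self] at h

theorem segreTangent_smul_le (r : Fin d → ℝ) (a : ∀ i, EuclideanSpace ℝ (Fin (n i))) :
    segreTangent (fun i => r i • a i) ≤ segreTangent a := by
  refine (segreTangent_le_iff _ _).2 fun i x => ?_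
  -- The replaced slot is not rescaled, hence the factor `1` there.
  have h : Function.update (fun i => r i • a i) i x =
      fun j => Function.update r i 1 j • Function.update a i x j := by
    funext j
    by_cases hj : j = i
    · subst hj; simp
    · simp [hj]
  rw [h, tensorProd_smul]
  exact Submodule.smul_mem _ _ (update_mem_segreTangent a i x)

theorem segreTangent_smul {r : Fin d → ℝ} (hr : ∀ i, r i ≠ 0)
    (a : ∀ i, EuclideanSpace ℝ (Fin (n i))) :
    segreTangent (fun i => r i • a i) = segreTangent a := by
  refine le_antisymm (segreTangent_smul_le r a) ?_
  have h := segreTangent_smul_le (fun i => (r i)⁻¹) (fun i => r i • a i)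
  simpa only [inv_smul_smul₀ (hr _)] using h

end Multilinear

/-! ### Velocities of curves of rank-one tensors. -/

section TangentVectors

variable {d : ℕ} {n : Fin d → ℕ}

/-- The curve `⊗ (a_i + t y_i)` has the required velocity, and its factors stay nonzero for small
`t`. -/
theorem segreTangent_subset_tangentVectors {a : ∀ i, EuclideanSpace ℝ (Fin (n i))}
    (ha : ∀ i, a i ≠ 0) :
    (segreTangent a : Set (Tensor n)) ⊆ tangentVectors (segre n) (tensorProd a) := by
  rintro _ ⟨y, rfl⟩
  have hne : ∀ᶠ t : ℝ in 𝓝 0, ∀ i, a i + t • y i ≠ 0 := by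
    refine Filter.eventually_all.2 fun i => ?_
    have hc : ContinuousAt (fun t : ℝ => a i + t • y i) 0 := by fun_prop
    exact hc.eventually_ne (by simpa using ha i)
  obtain ⟨ε, hε, hne⟩ := Metric.eventually_nhds_iff.1 hne
  refine ⟨ε, hε, fun t => tensorProd (fun i => a i + t • y i), ?_, ?_, ?_, ?_⟩
  · refine ContDiff.contDiffOn ?_
    refine (tensorProdL n).contDiff.comp (contDiff_pi.2 fun i => ?_)
    fun_prop
  · intro t ht
    refine ⟨_, hne ?_, rfl⟩
    rw [Real.dist_eq, sub_zero, abs_lt]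
    exact ht
  · simp
  · have h1 : HasDerivAt (fun t : ℝ => fun i => a i + t • y i) y 0 := by
      refine hasDerivAt_pi.2 fun i => ?_
      simpa using ((hasDerivAt_id (0 : ℝ)).smul_const (y i)).const_add (a i)
    have h2 : HasFDerivAt (tensorProdL n) ((tensorProdL n).linearDeriv a)
        (fun i => a i + (0 : ℝ) • y i) := by
      have h := (tensorProdL n).hasFDerivAt a
      simpa using h
    exact h2.comp_hasDerivAt (0 : ℝ) h1

/-- The fibre of a tensor in the `i`-th direction through the entry `k`. -/
def tensorFiber (k : ∀ i, Fin (n i)) (i : Fin d) : Tensor n →L[ℝ] EuclideanSpace ℝ (Fin (n i)) :=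
  LinearMap.toContinuousLinearMap
    { toFun := fun B => WithLp.toLp 2 fun x => B (Function.update k i x)
      map_add' := fun _ _ => rfl
      map_smul' := fun _ _ => rfl }

theorem tensorFiber_apply (k : ∀ i, Fin (n i)) (i : Fin d) (B : Tensor n) (x : Fin (n i)) :
    tensorFiber k i B x = B (Function.update k i x) := rfl

theorem tensorFiber_tensorProd (k : ∀ i, Fin (n i)) (i : Fin d)
    (a : ∀ i, EuclideanSpace ℝ (Fin (n i))) :
    tensorFiber k i (tensorProd a) = (∏ j ∈ Finset.univ.erase i, a j (k j)) • a i := by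
  ext x
  rw [tensorFiber_apply, tensorProd_apply, PiLp.smul_apply, smul_eq_mul, mul_comm,
    ← Finset.mul_prod_erase Finset.univ _ (Finset.mem_univ i), Function.update_self]
  congr 1
  refine Finset.prod_congr rfl fun j hj => ?_
  rw [Function.update_of_ne (Finset.ne_of_mem_erase hj)]

/-- A rank-one tensor is, up to a power of one of its entries, the tensor product of its fibres
through this entry. -/
theorem pow_smul_eq_of_mem_segre {B : Tensor n} (hB : B ∈ segre n) (k : ∀ i, Fin (n i)) :
    B k ^ d • B = B k • tensorProd fun i => tensorFiber k i B := by
  obtain ⟨a, ha, rfl⟩ := hB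
  simp only [tensorFiber_tensorProd]
  rw [tensorProd_smul, smul_smul]
  by_cases h0 : tensorProd a k = 0
  · rcases Nat.eq_zero_or_pos d with rfl | hd
    · rw [tensorProd_apply] at h0
      simp at h0
    · rw [h0, zero_pow hd.ne', zero_mul]
  congr 1
  -- The entry `a i (k i)` completes the coefficient of the `i`-th fibre to the full entry of the
  -- tensor. The extra factor `B k` on both sides of the identity avoids the exponent `d - 1`.
  have h : ∏ i, (a i (k i) * ∏ j ∈ Finset.univ.erase i, a j (k j)) =
      tensorProd a k ^ d := by
    rw [Finset.prod_congr rfl fun i _ => Finset.mul_prod_erase Finset.univ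
      (fun j => a j (k j)) (Finset.mem_univ i)]
    simp [tensorProd_apply]
  rw [← h, Finset.prod_mul_distrib, tensorProd_apply]

/-- A curve in the Segre manifold comes without smooth factors. Its fibres through a nonzero entry
of `A` serve as factors up to a scalar: they are linear in the tensor, hence differentiable along
the curve. -/
theorem tangentVectors_subset_segreTangent (hd : 1 ≤ d) {a : ∀ i, EuclideanSpace ℝ (Fin (n i))}
    (ha : ∀ i, a i ≠ 0) :
    tangentVectors (segre n) (tensorProd a) ⊆ (segreTangent a : Set (Tensor n)) := by
  rintro v ⟨ε, hε, γ, -, hγ, h0, hv⟩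
  choose k hk using fun i => exists_coord_ne_zero (ha i)
  have hk0 : tensorProd a k ≠ 0 := by
    rw [tensorProd_apply]
    exact Finset.prod_ne_zero_iff.2 fun i _ => hk i
  have hentry : HasDerivAt (fun t => γ t k) (v k) 0 :=
    (EuclideanSpace.proj (𝕜 := ℝ) k).hasFDerivAt.comp_hasDerivAt (0 : ℝ) hv
  have hfib : HasDerivAt (fun t => fun i => tensorFiber k i (γ t))
      (fun i => tensorFiber k i v) 0 :=
    hasDerivAt_pi.2 fun i => (tensorFiber k i).hasFDerivAt.comp_hasDerivAt (0 : ℝ) hv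
  have hprod : HasDerivAt (fun t => tensorProd fun i => tensorFiber k i (γ t))
      ((tensorProdL n).linearDeriv (fun i => tensorFiber k i (γ 0)) fun i => tensorFiber k i v) 0 :=
    ((tensorProdL n).hasFDerivAt _).comp_hasDerivAt (0 : ℝ) hfib
  have hl := (hentry.pow d).smul hv
  have hr := hentry.smul hprod
  have heq : (fun t => γ t k ^ d • γ t) =ᶠ[𝓝 0]
      fun t => γ t k • tensorProd fun i => tensorFiber k i (γ t) := by
    filter_upwards [Ioo_mem_nhds (neg_lt_zero.2 hε) hε] with t ht
    exact pow_smul_eq_of_mem_segre (hγ t ht) k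
  -- Comparing derivatives at `0` gives `A_k^d v + (⋯) A = A_k D + v_k F`, where `F` is the tensor
  -- product of the fibres of `A` and `D` is a derivative of the tensor product at these fibres. All
  -- terms but the first are tangent, and `A_k ≠ 0`.
  have key := hl.unique (hr.congr_of_eventuallyEq heq)
  simp only [h0, Pi.pow_apply] at key
  have hA : tensorProd a ∈ segreTangent a := tensorProd_mem_segreTangent hd a
  set r : Fin d → ℝ := fun i => ∏ j ∈ Finset.univ.erase i, a j (k j) with hr_def
  have hF : (fun i => tensorFiber k i (tensorProd a)) = fun i => r i • a i :=
    funext fun i => tensorFiber_tensorProd k i a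
  have h1 : (tensorProdL n).linearDeriv (fun i => tensorFiber k i (tensorProd a))
      (fun i => tensorFiber k i v) ∈ segreTangent a := by
    rw [hF]
    exact segreTangent_smul_le r a ⟨_, rfl⟩
  have h2 : (tensorProd fun i => tensorFiber k i (tensorProd a)) ∈ segreTangent a := by
    rw [hF, tensorProd_smul]
    exact Submodule.smul_mem _ _ hA
  have h3 : tensorProd a k ^ d • v ∈ segreTangent a := by
    rw [eq_sub_of_add_eq key]
    exact Submodule.sub_mem _ (Submodule.add_mem _ (Submodule.smul_mem _ _ h1)
      (Submodule.smul_mem _ _ h2)) (Submodule.smul_mem _ _ hA)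
  exact (Submodule.smul_mem_iff _ (pow_ne_zero d hk0)).1 h3

theorem segreTangent_eq_tangentVectors (hd : 1 ≤ d) {a : ∀ i, EuclideanSpace ℝ (Fin (n i))}
    (ha : ∀ i, a i ≠ 0) :
    (segreTangent a : Set (Tensor n)) = tangentVectors (segre n) (tensorProd a) :=
  (segreTangent_subset_tangentVectors ha).antisymm (tangentVectors_subset_segreTangent hd ha)

end TangentVectors

/-! ### Orthonormal bases of the tangent spaces. -/

section Frame

variable {d : ℕ} {n : Fin d → ℕ}

/-- The representatives of the factors of a point of the product of projective spaces. -/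
def ProjProd.reps (q : ProjProd n) (i : Fin d) : EuclideanSpace ℝ (Fin (n i)) := (q i).rep

theorem ProjSpace.inner_rep_rep {E : Type*} [NormedAddCommGroup E] [InnerProductSpace ℝ E]
    [FiniteDimensional ℝ E] (L : ProjSpace E) : ⟪L.rep, L.rep⟫_ℝ = 1 := by
  rw [ProjSpace.rep, Gr.inner_frame]
  simp

theorem ProjSpace.inner_rep_coframe {E : Type*} [NormedAddCommGroup E] [InnerProductSpace ℝ E]
    [FiniteDimensional ℝ E] (L : ProjSpace E) (x : EuclideanSpace ℝ (Fin (finrank ℝ E - 1))) :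
    ⟪L.rep, L.coframe x⟫_ℝ = 0 :=
  L.inner_frame_coframe _ _

theorem ProjSpace.exists_eq_smul_rep_add_coframe {E : Type*} [NormedAddCommGroup E]
    [InnerProductSpace ℝ E] [FiniteDimensional ℝ E] (L : ProjSpace E) (x : E) :
    ∃ c : ℝ, x = c • L.rep + L.coframe (L.coproj x) := by
  refine ⟨L.proj x 0, ?_⟩
  conv_lhs => rw [← L.frame_proj_add x]
  congr 1
  rw [ProjSpace.rep, ← map_smul]
  congr 1
  ext j
  rw [Subsingleton.elim j 0]
  simp

variable (n) in
/-- The index type of an orthonormal basis of a tangent space of the Segre manifold. -/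
abbrev SegreIndex : Type :=
  Option (Σ i : Fin d, Fin (finrank ℝ (EuclideanSpace ℝ (Fin (n i))) - 1))

theorem card_segreIndex : Fintype.card (SegreIndex n) = segreDim n := by
  rw [Fintype.card_option, Fintype.card_sigma, segreDim, add_comm]
  simp

/-- The vectors `a_1 ⊗ ⋯ ⊗ a_d` and `a_1 ⊗ ⋯ ⊗ b_i ⊗ ⋯ ⊗ a_d`, where the `b_i` run through an
orthonormal basis of the orthogonal complement of the unit vector `a_i`. -/
def segreFrame (q : ProjProd n) : SegreIndex n → Tensor n
  | none => tensorProd q.reps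
  | some ⟨i, m⟩ =>
      tensorProd (Function.update q.reps i ((q i).coframe (EuclideanSpace.single m 1)))

/-- Tensors `a_1 ⊗ ⋯ ⊗ x ⊗ ⋯ ⊗ a_d` are orthogonal to all tensor products with a factor
orthogonal to `a_j` in a slot `j` other than that of `x`. -/
theorem inner_update_tensorProd_eq_zero {a c : ∀ i, EuclideanSpace ℝ (Fin (n i))} {i j : Fin d}
    (hij : j ≠ i) (x : EuclideanSpace ℝ (Fin (n i))) (h : ⟪a j, c j⟫_ℝ = 0) :
    ⟪tensorProd (Function.update a i x), tensorProd c⟫_ℝ = 0 := by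
  rw [inner_tensorProd]
  exact Finset.prod_eq_zero (Finset.mem_univ j) (by rw [Function.update_of_ne hij, h])

theorem inner_tensorProd_update_update {a : ∀ i, EuclideanSpace ℝ (Fin (n i))}
    (ha : ∀ i, ⟪a i, a i⟫_ℝ = 1) (i : Fin d) (x y : EuclideanSpace ℝ (Fin (n i))) :
    ⟪tensorProd (Function.update a i x), tensorProd (Function.update a i y)⟫_ℝ = ⟪x, y⟫_ℝ := by
  rw [inner_tensorProd, ← Finset.mul_prod_erase Finset.univ _ (Finset.mem_univ i),
    Function.update_self, Function.update_self, Finset.prod_eq_one, mul_one]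
  intro j hj
  rw [Function.update_of_ne (Finset.ne_of_mem_erase hj),
    Function.update_of_ne (Finset.ne_of_mem_erase hj), ha]

theorem ProjProd.inner_reps (q : ProjProd n) (i : Fin d) : ⟪q.reps i, q.reps i⟫_ℝ = 1 :=
  (q i).inner_rep_rep

theorem inner_tensorProd_reps_update (q : ProjProd n) (i : Fin d)
    (x : EuclideanSpace ℝ (Fin (finrank ℝ (EuclideanSpace ℝ (Fin (n i))) - 1))) :
    ⟪tensorProd q.reps, tensorProd (Function.update q.reps i ((q i).coframe x))⟫_ℝ = 0 := by
  rw [inner_tensorProd]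
  refine Finset.prod_eq_zero (Finset.mem_univ i) ?_
  rw [Function.update_self]
  exact (q i).inner_rep_coframe x

/-- Inner products of tensor products are products over the slots. Vectors of different types or
with different replaced slots meet some `a_j` with a vector of its complement; with the same slot,
only the inner product of the replacements remains. -/
theorem orthonormal_segreFrame (q : ProjProd n) : Orthonormal ℝ (segreFrame q) := by
  rw [orthonormal_iff_ite]
  rintro (_ | ⟨i, m⟩) (_ | ⟨j, l⟩)
  · simp only [segreFrame, if_true]
    rw [inner_tensorProd, Finset.prod_eq_one fun i _ => q.inner_reps i]
  · rw [if_neg (by simp)]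
    exact inner_tensorProd_reps_update q j _
  · rw [real_inner_comm, if_neg (by simp)]
    exact inner_tensorProd_reps_update q i _
  · by_cases hij : i = j
    · subst hij
      simp only [segreFrame]
      rw [inner_tensorProd_update_update q.inner_reps, Gr.inner_coframe]
      simp [EuclideanSpace.inner_single_left]
    · rw [if_neg (by simp [hij])]
      refine inner_update_tensorProd_eq_zero (Ne.symm hij) _ ?_
      rw [Function.update_self]
      exact (q j).inner_rep_coframe _

theorem span_segreFrame (hd : 1 ≤ d) (q : ProjProd n) :
    Submodule.span ℝ (range (segreFrame q)) = segreTangent q.reps := by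
  refine le_antisymm ?_ ((segreTangent_le_iff _ _).2 fun i x => ?_)
  · refine Submodule.span_le.2 ?_
    rintro _ ⟨_ | ⟨i, m⟩, rfl⟩
    · exact tensorProd_mem_segreTangent hd _
    · exact update_mem_segreTangent _ _ _
  · obtain ⟨c, hc⟩ := (q i).exists_eq_smul_rep_add_coframe x
    rw [hc]
    change tensorProdL n (Function.update q.reps i _) ∈ _
    rw [ContinuousMultilinearMap.map_update_add, ContinuousMultilinearMap.map_update_smul]
    refine Submodule.add_mem _ (Submodule.smul_mem _ _ ?_) ?_
    · have h : Function.update q.reps i (q i).rep = q.reps := Function.update_eq_self i q.reps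
      rw [h]
      exact Submodule.subset_span ⟨none, rfl⟩
    · generalize (q i).coproj x = y
      have hy : y = ∑ m, y m • EuclideanSpace.single m (1 : ℝ) := by
        ext l
        simp [Finset.sum_apply, Pi.single_apply]
      let f := (((tensorProdL n).toContinuousLinearMap q.reps i).comp (q i).coframe)
      change f y ∈ _
      rw [hy, map_sum]
      refine Submodule.sum_mem _ fun m _ => ?_
      rw [map_smul]
      exact Submodule.smul_mem _ _ (Submodule.subset_span ⟨some ⟨i, m⟩, rfl⟩)

theorem finrank_segreTangent_reps (hd : 1 ≤ d) (q : ProjProd n) :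
    finrank ℝ (segreTangent q.reps) = segreDim n := by
  rw [← span_segreFrame hd q, finrank_span_eq_card (orthonormal_segreFrame q).linearIndependent,
    card_segreIndex]

/-- The tangent spaces of the Segre manifold as points of the Grassmannian. -/
def tangentGr (hd : 1 ≤ d) (q : ProjProd n) : Gr (Tensor n) (segreDim n) where
  toSubmodule := segreTangent q.reps
  finrank_eq := finrank_segreTangent_reps hd q

/-- Factors on the same lines differ by nonzero scalars. Any nonzero vectors on the lines can thus
replace the chosen unit ones, for the factors of a given tensor as well as for sheared factors. -/
theorem segreTangent_eq_of_mk_eq {q : ProjProd n} {a : ∀ i, EuclideanSpace ℝ (Fin (n i))}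
    (ha : ∀ i, a i ∈ (q i).toSubmodule) (ha0 : ∀ i, a i ≠ 0) :
    segreTangent a = segreTangent q.reps := by
  have h : ∀ i, ∃ r : ℝ, a i = r • (q i).rep := fun i =>
    (ProjSpace.mk_eq_mk_iff _ _ (ha0 i) (q i).rep_ne_zero).1
      ((ProjSpace.mk_eq_of_mem _ _ (ha0 i) (ha i)).trans (q i).mk_rep.symm)
  choose r hr using h
  obtain rfl : a = fun i => r i • q.reps i := funext hr
  refine segreTangent_smul (fun i h => ha0 i ?_) _
  simp [h]

theorem tangentGr_segreEquiv_symm (hd : 1 ≤ d) (A : Tensor n) (hA : A ∈ segre n) :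
    ((tangentGr hd ((segreEquiv n).symm (ProjSegre.ofTensor A hA))).toSubmodule : Set (Tensor n)) =
      tangentVectors (segre n) A := by
  obtain ⟨a, ha, rfl⟩ := hA
  have h : (segreEquiv n).symm (ProjSegre.ofTensor (tensorProd a) ⟨a, ha, rfl⟩) =
      fun i => ProjSpace.mk (a i) (ha i) := by
    rw [Equiv.symm_apply_eq]
    exact (segreMap_mk a ha).symm
  rw [h, ← segreTangent_eq_tangentVectors hd ha]
  congr 1
  refine (segreTangent_eq_of_mk_eq (fun i => ?_) ha).symm
  exact Submodule.mem_span_singleton_self _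

end Frame

/-! ### Tensor products of endomorphisms and their action on tangent spaces. -/

section TensorMap

variable {d : ℕ} {n : Fin d → ℕ}

variable (n) in
/-- Families of endomorphisms of the factors. -/
abbrev EndFactors : Type :=
  ∀ i, EuclideanSpace ℝ (Fin (n i)) →L[ℝ] EuclideanSpace ℝ (Fin (n i))

variable (n) in
/-- The family of identity maps. -/
def idFactors : EndFactors n := fun _ => ContinuousLinearMap.id ℝ _

/-- The tensor product of endomorphisms of the factors. -/
def tensorMap (g : EndFactors n) :
    Tensor n →L[ℝ] Tensor n :=
  ∑ l : ∀ i, Fin (n i), (EuclideanSpace.proj (𝕜 := ℝ) l : Tensor n →L[ℝ] ℝ).smulRight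
    (tensorProd fun i => g i (EuclideanSpace.single (l i) 1))

theorem tensorMap_apply
    (g : EndFactors n)
    (A : Tensor n) (k : ∀ i, Fin (n i)) :
    tensorMap g A k = ∑ l, A l * ∏ i, g i (EuclideanSpace.single (l i) 1) (k i) := by
  simp only [tensorMap, sum_apply, WithLp.ofLp_sum, Finset.sum_apply]
  rfl

theorem tensorMap_tensorProd
    (g : EndFactors n)
    (a : ∀ i, EuclideanSpace ℝ (Fin (n i))) :
    tensorMap g (tensorProd a) = tensorProd fun i => g i (a i) := by
  ext k
  have h : ∀ i, g i (a i) (k i) = ∑ l, a i l * g i (EuclideanSpace.single l 1) (k i) := by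
    intro i
    have ha : a i = ∑ l, a i l • EuclideanSpace.single l (1 : ℝ) := by
      ext l
      simp [Finset.sum_apply, Pi.single_apply]
    conv_lhs => rw [ha, map_sum]
    simp
  simp only [tensorMap_apply, tensorProd_apply, h]
  rw [Finset.prod_univ_sum, Fintype.piFinset_univ]
  exact Finset.sum_congr rfl fun l _ => Finset.prod_mul_distrib.symm

/-- Evaluation of a family of endomorphisms at a family of vectors. -/
def evalFactors (c : ∀ i, EuclideanSpace ℝ (Fin (n i))) :
    EndFactors n →L[ℝ]
      ∀ i, EuclideanSpace ℝ (Fin (n i)) :=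
  ContinuousLinearMap.pi fun i =>
    (ContinuousLinearMap.apply ℝ (EuclideanSpace ℝ (Fin (n i))) (c i)).comp
      (ContinuousLinearMap.proj
        (φ := fun i => EuclideanSpace ℝ (Fin (n i)) →L[ℝ] EuclideanSpace ℝ (Fin (n i))) i)

theorem contDiff_tensorMap : ContDiff ℝ ∞ (tensorMap (n := n)) := by
  unfold tensorMap
  refine ContDiff.sum fun l _ => ContDiff.smulRight contDiff_const ?_
  exact (tensorProdL n).contDiff.comp
    (evalFactors fun i => EuclideanSpace.single (l i) (1 : ℝ)).contDiff

theorem tensorMap_id : tensorMap (idFactors n) =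
    ContinuousLinearMap.id ℝ (Tensor n) := by
  ext A k
  simp only [tensorMap_apply, idFactors, ContinuousLinearMap.id_apply]
  rw [Finset.sum_eq_single k]
  · simp
  · intro l _ hl
    obtain ⟨i, hi⟩ := Function.ne_iff.1 hl
    rw [Finset.prod_eq_zero (Finset.mem_univ i), mul_zero]
    simp [hi.symm]
  · simp

/-- Replacing slot `i` by `x` and then applying `g` replaces slot `i` of the image by `g i x`. -/
theorem tensorMap_mem_segreTangent
    (g : EndFactors n)
    (a : ∀ i, EuclideanSpace ℝ (Fin (n i))) {B : Tensor n} (hB : B ∈ segreTangent a) :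
    tensorMap g B ∈ segreTangent fun i => g i (a i) := by
  have h : segreTangent a ≤ (segreTangent fun i => g i (a i)).comap
      (tensorMap g : Tensor n →ₗ[ℝ] Tensor n) := by
    refine (segreTangent_le_iff _ _).2 fun i x => ?_
    change tensorMap g _ ∈ segreTangent _
    rw [tensorMap_tensorProd]
    have h : (fun j => g j (Function.update a i x j)) =
        Function.update (fun j => g j (a j)) i (g i x) := by
      funext j
      by_cases hj : j = i
      · subst hj; simp
      · simp [hj]
    rw [h]
    exact update_mem_segreTangent _ _ _
  exact h hB

/-- The derivative of `g ↦ g_1 c_1 ⊗ ⋯ ⊗ g_d c_d` at the identity. -/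
theorem fderiv_tensorMap_tensorProd
    (N : EndFactors n) (c : ∀ i, EuclideanSpace ℝ (Fin (n i))) :
    fderiv ℝ (tensorMap (n := n)) (idFactors n) N (tensorProd c) =
      ∑ j, tensorProd (Function.update c j (N j (c j))) := by
  have h1 : HasFDerivAt (tensorMap (n := n)) (fderiv ℝ (tensorMap (n := n)) (idFactors n)) (idFactors n) :=
    ((contDiff_tensorMap (n := n)).differentiable (by simp)).differentiableAt.hasFDerivAt
  have h2 := (ContinuousLinearMap.apply ℝ (Tensor n) (tensorProd c)).hasFDerivAt.comp _ h1
  have h3 := HasFDerivAt.comp (idFactors n)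
    ((tensorProdL n).hasFDerivAt (evalFactors c (idFactors n))) (evalFactors c).hasFDerivAt
  -- Both derivatives belong to `g ↦ ⊗ g_i c_i`; the multilinear side makes the derivative explicit.
  have h4 : (tensorProdL n) ∘ evalFactors c =
      ContinuousLinearMap.apply ℝ (Tensor n) (tensorProd c) ∘ tensorMap :=
    funext fun g => (tensorMap_tensorProd g c).symm
  rw [h4] at h3
  have h5 := DFunLike.congr_fun (h2.unique h3) N
  exact h5.trans (linearDeriv_tensorProdL _ _)

end TensorMap

/-! ### Differential calculus of Grassmannian-valued maps given by frames. -/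

namespace Gr

variable {E : Type*} [NormedAddCommGroup E] [InnerProductSpace ℝ E] [FiniteDimensional ℝ E] {k : ℕ}

theorem proj_comp_frame (V : Gr E k) : V.proj ∘L V.frame = 1 :=
  ContinuousLinearMap.ext V.proj_frame

theorem coproj_comp_frame (V : Gr E k) : V.coproj ∘L V.frame = 0 :=
  ContinuousLinearMap.ext V.coproj_frame

theorem contDiffAt_slope (V : Gr E k) {w : EuclideanSpace ℝ (Fin k) →L[ℝ] E}
    (h : IsUnit (V.proj ∘L w)) : ContDiffAt ℝ ∞ V.slope w := by
  have h1 : ContDiff ℝ ∞ fun w : EuclideanSpace ℝ (Fin k) →L[ℝ] E => V.proj ∘L w :=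
    contDiff_const.clm_comp contDiff_id
  have h2 : ContDiff ℝ ∞ fun w : EuclideanSpace ℝ (Fin k) →L[ℝ] E => V.coproj ∘L w :=
    contDiff_const.clm_comp contDiff_id
  obtain ⟨u, hu⟩ := h
  have h3 : ContDiffAt ℝ ∞ Ring.inverse (V.proj ∘L w) := by
    rw [← hu]; exact contDiffAt_ringInverse ℝ u
  exact h2.contDiffAt.clm_comp (ContDiffAt.comp w (g := Ring.inverse) h3 h1.contDiffAt)

/-- The derivative of the slope over `V` at the frame of `V`. -/
theorem hasFDerivAt_slope_frame (V : Gr E k) :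
    HasFDerivAt V.slope
      (ContinuousLinearMap.compL ℝ (EuclideanSpace ℝ (Fin k)) E _ V.coproj) V.frame := by
  have h1 : HasFDerivAt (fun w : EuclideanSpace ℝ (Fin k) →L[ℝ] E => V.coproj ∘L w)
      (ContinuousLinearMap.compL ℝ (EuclideanSpace ℝ (Fin k)) E _ V.coproj) V.frame :=
    (ContinuousLinearMap.compL ℝ (EuclideanSpace ℝ (Fin k)) E _ V.coproj).hasFDerivAt
  have h2 : DifferentiableAt ℝ
      (fun w : EuclideanSpace ℝ (Fin k) →L[ℝ] E => Ring.inverse (V.proj ∘L w)) V.frame := by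
    have h3 : DifferentiableAt ℝ Ring.inverse (V.proj ∘L V.frame) := by
      rw [proj_comp_frame]
      exact (hasFDerivAt_ringInverse (𝕜 := ℝ)
        (1 : (EuclideanSpace ℝ (Fin k) →L[ℝ] EuclideanSpace ℝ (Fin k))ˣ)).differentiableAt
    exact DifferentiableAt.comp V.frame (g := Ring.inverse) h3
      (ContinuousLinearMap.compL ℝ (EuclideanSpace ℝ (Fin k)) E _ V.proj).differentiableAt
  have h := h1.clm_comp h2.hasFDerivAt
  refine h.congr_fderiv ?_
  ext1 w
  ext1 x
  -- The derivative of the inverse is multiplied by `coproj ∘ frame = 0`, so only the variation of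
  -- `coproj ∘ w` survives.
  simp [proj_comp_frame, coproj_comp_frame]

/-- The unit forces `w` to be injective, so equality of dimensions turns the inclusion of its range
into an equality. Consequently frames only have to be checked to lie in the subspace. -/
theorem chart_eq_of_range_le (V W : Gr E k) {w : EuclideanSpace ℝ (Fin k) →L[ℝ] E}
    (h : IsUnit (V.proj ∘L w)) (hw : w.range ≤ W.toSubmodule) :
    W ∈ V.chart.source ∧ V.chart W = V.slope w := by
  have hinj : Function.Injective w := by
    have h' := ((ContinuousLinearMap.isUnit_iff_bijective).1 h).1
    exact Function.Injective.of_comp (f := V.proj) h'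
  have hr : w.range = W.toSubmodule := by
    refine Submodule.eq_of_le_of_finrank_eq hw ?_
    rw [W.finrank_eq]
    have h' := LinearMap.finrank_range_of_inj (f := (w : EuclideanSpace ℝ (Fin k) →ₗ[ℝ] E)) hinj
    simpa using h'
  have hg := V.graph_slope W w hr h
  refine ⟨(V.disjoint_iff_isUnit W w hinj hr).2 h, ?_⟩
  have h2 := (V.slope_of_range_eq (V.slope w) W.frame W.frame_injective
    (by rw [hg, range_frame])).2
  exact h2

section Smooth

variable {F : Type*} [NormedAddCommGroup F] [NormedSpace ℝ F] {H : Type*} [TopologicalSpace H]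
  {I : ModelWithCorners ℝ F H} {M : Type*} [TopologicalSpace M] [ChartedSpace H M]

theorem eventually_chart_eq_slope {f : M → Gr E k} {p : M}
    {w : F → EuclideanSpace ℝ (Fin k) →L[ℝ] E} (hw : ContinuousAt w (extChartAt I p p))
    (h0 : w (extChartAt I p p) = (f p).frame)
    (hr : ∀ᶠ x in 𝓝 (extChartAt I p p), (w x).range ≤ (f ((extChartAt I p).symm x)).toSubmodule) :
    ∀ᶠ x in 𝓝 (extChartAt I p p), IsUnit ((f p).proj ∘L w x) ∧
      f ((extChartAt I p).symm x) ∈ (f p).chart.source ∧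
        (f p).chart (f ((extChartAt I p).symm x)) = (f p).slope (w x) := by
  have hc : ContinuousAt (fun x => (f p).proj ∘L w x) (extChartAt I p p) :=
    ((ContinuousLinearMap.compL ℝ (EuclideanSpace ℝ (Fin k)) E _ (f p).proj).continuous.continuousAt
      ).comp hw
  have hu : ∀ᶠ x in 𝓝 (extChartAt I p p), IsUnit ((f p).proj ∘L w x) := by
    refine hc.eventually_mem (Units.isOpen.mem_nhds ?_)
    rw [mem_ofPred_eq, h0, proj_comp_frame]
    exact isUnit_one
  filter_upwards [hu, hr] with x hx hx'
  exact ⟨hx, (f p).chart_eq_of_range_le _ hx hx'⟩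

/-- A map to the Grassmannian is smooth at `p` if, near `p`, its values are spanned by frames which
depend smoothly on the point. -/
theorem contMDiffAt_of_frames {f : M → Gr E k} {p : M}
    {w : F → EuclideanSpace ℝ (Fin k) →L[ℝ] E} (hw : ContDiffAt ℝ ∞ w (extChartAt I p p))
    (h0 : w (extChartAt I p p) = (f p).frame)
    (hr : ∀ᶠ x in 𝓝 (extChartAt I p p), (w x).range ≤ (f ((extChartAt I p).symm x)).toSubmodule) :
    ContMDiffAt I 𝓘(ℝ, GrModel E k) ∞ f p := by
  have hev := eventually_chart_eq_slope hw.continuousAt h0 hr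
  have hs : ContDiffAt ℝ ∞ (fun x => (f p).slope (w x)) (extChartAt I p p) := by
    refine ContDiffAt.comp (extChartAt I p p) (g := (f p).slope) ?_ hw
    exact (f p).contDiffAt_slope hev.self_of_nhds.1
  refine contMDiffAt_iff.2 ⟨?_, ?_⟩
  · have hc : ContinuousAt (fun x => (extChartAt 𝓘(ℝ, GrModel E k) (f p)).symm
        ((f p).slope (w x))) (extChartAt I p p) := by
      refine ContinuousAt.comp (g := (extChartAt 𝓘(ℝ, GrModel E k) (f p)).symm) ?_ hs.continuousAt
      have htar : (extChartAt 𝓘(ℝ, GrModel E k) (f p)).target = univ := by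
        rw [extChartAt_target]
        change _ ⁻¹' univ ∩ _ = _
        simp
      exact (continuousOn_extChartAt_symm (I := 𝓘(ℝ, GrModel E k)) (f p)).continuousAt
        (by rw [htar]; exact Filter.univ_mem)
    refine (hc.comp (continuousAt_extChartAt (I := I) p)).congr ?_
    filter_upwards [(continuousAt_extChartAt (I := I) p).eventually hev,
      extChartAt_source_mem_nhds (I := I) p] with q hq hq'
    rw [(extChartAt I p).left_inv hq'] at hq
    rw [Function.comp_apply, ← hq.2.2]
    exact (f p).chart.left_inv hq.2.1
  · refine (hs.congr_of_eventuallyEq ?_).contDiffWithinAt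
    filter_upwards [hev] with x hx
    exact hx.2.2

/-- In the chart centred at `f p`, the map is the slope of `w`, and the slope has derivative `coproj
∘ ·` at the frame of `f p`. -/
theorem mfderiv_apply_of_frames {f : M → Gr E k} {p : M} (hI : range I = univ)
    {w : F → EuclideanSpace ℝ (Fin k) →L[ℝ] E} (hw : ContDiffAt ℝ ∞ w (extChartAt I p p))
    (h0 : w (extChartAt I p p) = (f p).frame)
    (hr : ∀ᶠ x in 𝓝 (extChartAt I p p), (w x).range ≤ (f ((extChartAt I p).symm x)).toSubmodule)
    (u : TangentSpace I p) :
    (f p).toHom (mfderiv I 𝓘(ℝ, GrModel E k) f p u) =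
      (f p).coproj ∘L fderiv ℝ w (extChartAt I p p) u := by
  have hev := eventually_chart_eq_slope hw.continuousAt h0 hr
  have hsm := (contMDiffAt_of_frames hw h0 hr).mdifferentiableAt (by simp)
  have h1 : HasFDerivAt w (fderiv ℝ w (extChartAt I p p)) (extChartAt I p p) :=
    (hw.differentiableAt (by simp)).hasFDerivAt
  have h2 := (f p).hasFDerivAt_slope_frame
  rw [← h0] at h2
  have h3 := h2.comp _ h1
  have h4 : HasFDerivAt (writtenInExtChartAt I 𝓘(ℝ, GrModel E k) p f) _ _ :=
    h3.congr_of_eventuallyEq (by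
    filter_upwards [hev] with x hx
    exact hx.2.2)
  rw [toHom, hsm.mfderiv, hI, fderivWithin_univ, h4.fderiv]
  rfl

end Smooth

theorem frame_proj (V : Gr E k) {x : E} (hx : x ∈ V.toSubmodule) : V.frame (V.proj x) = x := by
  rw [← range_frame] at hx
  obtain ⟨a, rfl⟩ := hx
  exact congrArg V.frame (V.proj_frame a)

/-- The standard metric as a sum over an orthonormal basis of the subspace. -/
theorem standardMetric_eq_sum (V : Gr E k) {ι : Type*} [Fintype ι] {e : ι → E}
    (he : Orthonormal ℝ e) (hcard : Fintype.card ι = k) (hV : ∀ i, e i ∈ V.toSubmodule)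
    (u v : TangentSpace 𝓘(ℝ, GrModel E k) V) :
    V.standardMetric u v = ∑ i, ⟪V.toHom u (V.proj (e i)), V.toHom v (V.proj (e i))⟫_ℝ := by
  have hfp : ∀ i, V.frame (V.proj (e i)) = e i := fun i => V.frame_proj (hV i)
  -- On `V` the map `proj` inverts the isometry `frame`; the cardinality then makes this orthonormal
  -- family a basis in which the trace can be computed.
  have ho : Orthonormal ℝ fun i => V.proj (e i) := by
    classical
    rw [orthonormal_iff_ite] at he ⊢
    intro i j
    rw [← V.inner_frame, hfp, hfp, he]
  have hspan : ⊤ ≤ Submodule.span ℝ (range fun i => V.proj (e i)) := by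
    refine (ho.linearIndependent.span_eq_top_of_card_eq_finrank' ?_).ge
    rw [hcard, finrank_euclideanSpace_fin]
  obtain ⟨b, hb⟩ : ∃ b : OrthonormalBasis ι ℝ (EuclideanSpace ℝ (Fin k)),
      ∀ i, b i = V.proj (e i) :=
    ⟨OrthonormalBasis.mk ho hspan, fun i => by rw [OrthonormalBasis.coe_mk]⟩
  rw [standardMetric, LinearMap.trace_eq_sum_inner _ b]
  refine Finset.sum_congr rfl fun i _ => ?_
  rw [hb]
  exact ContinuousLinearMap.adjoint_inner_right (V.toHom u) (V.proj (e i))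
    (V.toHom v (V.proj (e i)))

theorem standardMetric_zero_right (V : Gr E k) (u : TangentSpace 𝓘(ℝ, GrModel E k) V) :
    V.standardMetric u 0 = 0 := by
  have h : V.toHom 0 = 0 := rfl
  rw [standardMetric, h, ContinuousLinearMap.comp_zero, ContinuousLinearMap.toLinearMap_zero,
    map_zero]

theorem inner_coproj (V : Gr E k) {x y : E} (hx : x ∈ V.toSubmoduleᗮ) :
    ⟪V.coproj x, V.coproj y⟫_ℝ = ⟪x, y⟫_ℝ := by
  rw [← range_coframe] at hx
  obtain ⟨a, rfl⟩ := hx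
  change ⟪V.coproj (V.coframe a), V.coproj y⟫_ℝ = ⟪V.coframe a, y⟫_ℝ
  rw [coproj_coframe, ContinuousLinearMap.adjoint_inner_right]

theorem coproj_eq_zero (V : Gr E k) {x : E} (hx : x ∈ V.toSubmodule) : V.coproj x = 0 := by
  rw [← range_frame] at hx
  obtain ⟨a, rfl⟩ := hx
  exact V.coproj_frame a

end Gr

/-! ### The charts of the projectivized Segre manifold. -/

section Charts

variable {d : ℕ} {n : Fin d → ℕ}

theorem range_segreModel : range (segreModel n) = univ :=
  range_eq_univ.2 fun y => ⟨y, rfl⟩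

theorem segreEquiv_symm_extChartAt_symm (p : ProjSegre n)
    (x : ∀ i, GrModel (EuclideanSpace ℝ (Fin (n i))) 1) :
    (segreEquiv n).symm ((extChartAt (segreModel n) p).symm x) =
      fun i => ((segreEquiv n).symm p i).graph (x i) :=
  (segreHomeomorph n).apply_symm_apply _

theorem extChartAt_projSegre_self (p : ProjSegre n) : extChartAt (segreModel n) p p = 0 := by
  funext i
  change ((segreEquiv n).symm p i).slope ((segreEquiv n).symm p i).frame = 0
  rw [Gr.slope, Gr.coproj_comp_frame, ContinuousLinearMap.zero_comp]

/-- In the charts of `ℙS` and of the product of projective spaces, the inverse of the Segre map is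
the identity. -/
theorem mfderiv_segreEquiv_symm (p : ProjSegre n) :
    mfderiv (segreModel n) (segreModel n) (segreEquiv n).symm p =
      ContinuousLinearMap.id ℝ (∀ i, GrModel (EuclideanSpace ℝ (Fin (n i))) 1) := by
  have h : HasMFDerivAt (segreModel n) (segreModel n) (segreEquiv n).symm p
      (ContinuousLinearMap.id ℝ (∀ i, GrModel (EuclideanSpace ℝ (Fin (n i))) 1)) := by
    refine ⟨(segreHomeomorph n).continuous.continuousAt, ?_⟩
    refine ((hasFDerivAt_id _).congr_of_eventuallyEq
      (Filter.Eventually.of_forall fun x => ?_)).hasFDerivWithinAt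
    funext i
    change ((segreEquiv n).symm p i).chart
      ((segreEquiv n).symm ((extChartAt (segreModel n) p).symm x) i) = x i
    rw [segreEquiv_symm_extChartAt_symm]
    exact ((segreEquiv n).symm p i).chart.right_inv (mem_univ _)
  exact h.mfderiv

end Charts

/-! ### Shears of the factors and the moving frame they produce. -/

section Shear

variable {d : ℕ} {n : Fin d → ℕ}

/-- The nilpotent endomorphisms `L → Lᗮ` of the factors given by tangent vectors at the lines
`L`. -/
def nilFactors (q : ProjProd n) :
    (∀ i, GrModel (EuclideanSpace ℝ (Fin (n i))) 1) →L[ℝ] EndFactors n :=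
  ContinuousLinearMap.pi fun i =>
    ((ContinuousLinearMap.compL ℝ _ _ _ (q i).coframe) ∘L
      ((ContinuousLinearMap.compL ℝ (EuclideanSpace ℝ (Fin (n i))) _ _).flip (q i).proj)) ∘L
        (ContinuousLinearMap.proj (φ := fun i => GrModel (EuclideanSpace ℝ (Fin (n i))) 1) i)

theorem nilFactors_apply (q : ProjProd n) (x : ∀ i, GrModel (EuclideanSpace ℝ (Fin (n i))) 1)
    (i : Fin d) (y : EuclideanSpace ℝ (Fin (n i))) :
    nilFactors q x i y = (q i).coframe (x i ((q i).proj y)) := rfl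

theorem nilFactors_rep (q : ProjProd n) (x : ∀ i, GrModel (EuclideanSpace ℝ (Fin (n i))) 1)
    (i : Fin d) :
    nilFactors q x i (q.reps i) = (q i).coframe (x i (EuclideanSpace.single 0 1)) := by
  rw [nilFactors_apply, ProjProd.reps, ProjSpace.rep, Gr.proj_frame]

theorem nilFactors_coframe (q : ProjProd n) (x : ∀ i, GrModel (EuclideanSpace ℝ (Fin (n i))) 1)
    (i : Fin d) (y : EuclideanSpace ℝ (Fin (finrank ℝ (EuclideanSpace ℝ (Fin (n i))) - 1))) :
    nilFactors q x i ((q i).coframe y) = 0 := by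
  rw [nilFactors_apply, Gr.proj_coframe, map_zero, map_zero]

/-- A smooth family of frames of the tangent spaces of the Segre manifold. -/
def shearFrame (hd : 1 ≤ d) (q : ProjProd n)
    (x : ∀ i, GrModel (EuclideanSpace ℝ (Fin (n i))) 1) :
    EuclideanSpace ℝ (Fin (segreDim n)) →L[ℝ] Tensor n :=
  tensorMap (idFactors n + nilFactors q x) ∘L (tangentGr hd q).frame

theorem contDiff_shearFrame (hd : 1 ≤ d) (q : ProjProd n) : ContDiff ℝ ∞ (shearFrame hd q) := by
  refine ContDiff.clm_comp ?_ contDiff_const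
  exact contDiff_tensorMap.comp (contDiff_const.add (nilFactors q).contDiff)

theorem shearFrame_zero (hd : 1 ≤ d) (q : ProjProd n) :
    shearFrame hd q 0 = (tangentGr hd q).frame := by
  rw [shearFrame, map_zero, add_zero, tensorMap_id, ContinuousLinearMap.id_comp]

theorem fderiv_shearFrame_zero (hd : 1 ≤ d) (q : ProjProd n)
    (u : ∀ i, GrModel (EuclideanSpace ℝ (Fin (n i))) 1) :
    fderiv ℝ (shearFrame hd q) 0 u =
      fderiv ℝ (tensorMap (n := n)) (idFactors n) (nilFactors q u) ∘L (tangentGr hd q).frame := by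
  have h1 : HasFDerivAt (tensorMap (n := n)) (fderiv ℝ (tensorMap (n := n)) (idFactors n))
      (idFactors n + nilFactors q 0) := by
    rw [map_zero, add_zero]
    exact ((contDiff_tensorMap (n := n)).differentiable (by simp)).differentiableAt.hasFDerivAt
  have h2 : HasFDerivAt (fun x => idFactors n + nilFactors q x) (nilFactors q) 0 :=
    (nilFactors q).hasFDerivAt.const_add _
  have h3 := h1.comp (0 : ∀ i, GrModel (EuclideanSpace ℝ (Fin (n i))) 1) h2
  have h4 := ((ContinuousLinearMap.compL ℝ (EuclideanSpace ℝ (Fin (segreDim n))) (Tensor n)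
    (Tensor n)).flip (tangentGr hd q).frame).hasFDerivAt.comp
      (0 : ∀ i, GrModel (EuclideanSpace ℝ (Fin (n i))) 1) h3
  have h5 : HasFDerivAt (shearFrame hd q) _ 0 := h4
  rw [h5.fderiv]
  rfl

/-- The shear `id + N_i` sends the unit vector of the `i`-th line to a spanning vector of the graph
of `x i`, so the tensor product of the shears maps into the tangent space at the displaced point. -/
theorem range_shearFrame_le (hd : 1 ≤ d) (q : ProjProd n)
    (x : ∀ i, GrModel (EuclideanSpace ℝ (Fin (n i))) 1) :
    (shearFrame hd q x).range ≤ (tangentGr hd fun i => (q i).graph (x i)).toSubmodule := by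
  rintro _ ⟨y, rfl⟩
  have hy : (tangentGr hd q).frame y ∈ segreTangent q.reps := by
    change _ ∈ (tangentGr hd q).toSubmodule
    rw [← Gr.range_frame]
    exact ⟨y, rfl⟩
  have h := tensorMap_mem_segreTangent (idFactors n + nilFactors q x) _ hy
  have hg : ∀ i, (idFactors n + nilFactors q x) i (q.reps i) =
      (q i).graphMap (x i) (EuclideanSpace.single 0 1) := fun i =>
    congrArg (fun z => q.reps i + z) (nilFactors_rep q x i)
  rw [segreTangent_eq_of_mk_eq (q := fun i => (q i).graph (x i))] at h
  · exact h
  · intro i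
    rw [hg]
    exact ⟨_, rfl⟩
  · intro i
    rw [hg]
    intro h0
    have h1 := (q i).graphMap_injective (x i) (h0.trans (map_zero _).symm)
    simp at h1

end Shear

/-! ### Comparison of the two metrics. -/

section Metric

variable {d : ℕ} {n : Fin d → ℕ}

/-- The immersion of `ℙS` into the Grassmannian. -/
def segreGauss (hd : 1 ≤ d) (p : ProjSegre n) : Gr (Tensor n) (segreDim n) :=
  tangentGr hd ((segreEquiv n).symm p)

theorem eventually_range_shearFrame_le (hd : 1 ≤ d) (p : ProjSegre n) :
    ∀ᶠ x in 𝓝 (extChartAt (segreModel n) p p), (shearFrame hd ((segreEquiv n).symm p) x).range ≤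
      (segreGauss hd ((extChartAt (segreModel n) p).symm x)).toSubmodule := by
  refine Filter.Eventually.of_forall fun x => ?_
  rw [segreGauss, segreEquiv_symm_extChartAt_symm]
  exact range_shearFrame_le hd _ x

theorem contMDiff_segreGauss (hd : 1 ≤ d) :
    ContMDiff (segreModel n) 𝓘(ℝ, GrModel (Tensor n) (segreDim n)) ∞ (segreGauss (n := n) hd) :=
  fun p => Gr.contMDiffAt_of_frames (contDiff_shearFrame hd _).contDiffAt
    (by rw [extChartAt_projSegre_self, shearFrame_zero]; rfl)
    (eventually_range_shearFrame_le hd p)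

/-- The velocity of `a_1 ⊗ ⋯ ⊗ a_d` and `a_1 ⊗ ⋯ ⊗ b_i ⊗ ⋯ ⊗ a_d` under the infinitesimal
rotation of the lines `a_j` in the directions `u_j`. -/
theorem toHom_mfderiv_segreGauss (hd : 1 ≤ d) (p : ProjSegre n)
    (u : ∀ i, GrModel (EuclideanSpace ℝ (Fin (n i))) 1) {c : ∀ i, EuclideanSpace ℝ (Fin (n i))}
    (hc : tensorProd c ∈ (segreGauss hd p).toSubmodule) :
    (segreGauss hd p).toHom (mfderiv (segreModel n) 𝓘(ℝ, GrModel (Tensor n) (segreDim n))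
      (segreGauss hd) p u) ((segreGauss hd p).proj (tensorProd c)) =
    (segreGauss hd p).coproj (∑ j, tensorProd
      (Function.update c j (nilFactors ((segreEquiv n).symm p) u j (c j)))) := by
  have h0 := Gr.mfderiv_apply_of_frames range_segreModel (contDiff_shearFrame hd _).contDiffAt
    (by rw [extChartAt_projSegre_self, shearFrame_zero]; rfl)
    (eventually_range_shearFrame_le hd p) u
  rw [extChartAt_projSegre_self] at h0
  refine (DFunLike.congr_fun h0 _).trans ?_
  refine (congrArg (fun T : _ →L[ℝ] Tensor n => (segreGauss hd p).coproj
    (T ((segreGauss hd p).proj (tensorProd c)))) (fderiv_shearFrame_zero hd _ u)).trans ?_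
  rw [← fderiv_tensorMap_tensorProd]
  exact congrArg (fun B => (segreGauss hd p).coproj (fderiv ℝ (tensorMap (n := n)) (idFactors n)
    (nilFactors ((segreEquiv n).symm p) u) B)) ((segreGauss hd p).frame_proj hc)

/-- The normal component of the velocity of `a_1 ⊗ ⋯ ⊗ b_i ⊗ ⋯ ⊗ a_d`. -/
def normalVelocity (q : ProjProd n) (u : ∀ i, GrModel (EuclideanSpace ℝ (Fin (n i))) 1)
    (i : Fin d) (b : EuclideanSpace ℝ (Fin (n i))) : Tensor n :=
  ∑ j ∈ Finset.univ.erase i, tensorProd (Function.update (Function.update q.reps i b) j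
    ((q j).coframe (u j (EuclideanSpace.single 0 1))))

/-- Each summand has two slots, `i` and `j`, orthogonal to `a_i` and `a_j`, while a generator of the
tangent space departs from `a` in one slot only. One of the two slots therefore makes the inner
product vanish. -/
theorem normalVelocity_mem_orthogonal (hd : 1 ≤ d) (q : ProjProd n)
    (u : ∀ i, GrModel (EuclideanSpace ℝ (Fin (n i))) 1) (i : Fin d)
    (y : EuclideanSpace ℝ (Fin (finrank ℝ (EuclideanSpace ℝ (Fin (n i))) - 1))) :
    normalVelocity q u i ((q i).coframe y) ∈ (tangentGr hd q).toSubmoduleᗮ := by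
  refine Submodule.sum_mem _ fun j hj => ?_
  have hji := Finset.ne_of_mem_erase hj
  set T := tensorProd (Function.update (Function.update q.reps i ((q i).coframe y)) j
    ((q j).coframe (u j (EuclideanSpace.single 0 1)))) with hT
  have hle : segreTangent q.reps ≤ (ℝ ∙ T)ᗮ := by
    refine (segreTangent_le_iff _ _).2 fun l x => ?_
    rw [Submodule.mem_orthogonal_singleton_iff_inner_left, hT]
    by_cases hjl : j = l
    · refine inner_update_tensorProd_eq_zero (j := i) (fun h => hji (hjl.trans h.symm)) x ?_
      rw [Function.update_of_ne hji.symm, Function.update_self]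
      exact (q i).inner_rep_coframe _
    · refine inner_update_tensorProd_eq_zero hjl x ?_
      rw [Function.update_self]
      exact (q j).inner_rep_coframe _
  rw [Submodule.mem_orthogonal]
  exact fun B hB => Submodule.mem_orthogonal_singleton_iff_inner_left.1 (hle hB)

/-- Summands for distinct `j` and `l` are orthogonal through slot `l`; for equal indices the other
factors are unit vectors. -/
theorem inner_normalVelocity (q : ProjProd n)
    (u v : ∀ i, GrModel (EuclideanSpace ℝ (Fin (n i))) 1) (i : Fin d)
    {b : EuclideanSpace ℝ (Fin (n i))} (hb : ⟪b, b⟫_ℝ = 1) :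
    ⟪normalVelocity q u i b, normalVelocity q v i b⟫_ℝ =
      ∑ j ∈ Finset.univ.erase i, (q j).fubiniStudy (u j) (v j) := by
  have hr : ∀ j, ⟪Function.update q.reps i b j, Function.update q.reps i b j⟫_ℝ = 1 := by
    intro j
    by_cases hj : j = i
    · subst hj; simpa using hb
    · rw [Function.update_of_ne hj, q.inner_reps]
  rw [normalVelocity, normalVelocity, sum_inner]
  refine Finset.sum_congr rfl fun j hj => ?_
  rw [inner_sum, Finset.sum_eq_single_of_mem j hj]
  · rw [inner_tensorProd_update_update hr, Gr.inner_coframe]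
    rfl
  · intro l hl hlj
    refine inner_update_tensorProd_eq_zero hlj _ ?_
    rw [Function.update_self, Function.update_of_ne (Finset.ne_of_mem_erase hl)]
    exact (q l).inner_rep_coframe _

theorem standardMetric_mfderiv_segreGauss (hd : 1 ≤ d) (hn : ∀ i, 1 ≤ n i) (p : ProjSegre n)
    (u v : ∀ i, GrModel (EuclideanSpace ℝ (Fin (n i))) 1) :
    (segreGauss hd p).standardMetric
      (mfderiv (segreModel n) 𝓘(ℝ, GrModel (Tensor n) (segreDim n)) (segreGauss hd) p u)
      (mfderiv (segreModel n) 𝓘(ℝ, GrModel (Tensor n) (segreDim n)) (segreGauss hd) p v) =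
    ∑ i, ((segreDim n : ℝ) - n i) * ((segreEquiv n).symm p i).fubiniStudy (u i) (v i) := by
  set q := (segreEquiv n).symm p with hq
  have hspan : ∀ e, segreFrame q e ∈ (segreGauss hd p).toSubmodule := by
    intro e
    change _ ∈ segreTangent q.reps
    rw [← span_segreFrame hd q]
    exact Submodule.subset_span ⟨e, rfl⟩
  rw [Gr.standardMetric_eq_sum _ (orthonormal_segreFrame q) card_segreIndex hspan,
    Fintype.sum_option, Fintype.sum_sigma]
  have hnone : ∀ w : ∀ i, GrModel (EuclideanSpace ℝ (Fin (n i))) 1, (segreGauss hd p).toHom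
      (mfderiv (segreModel n) 𝓘(ℝ, GrModel (Tensor n) (segreDim n)) (segreGauss hd) p w)
      ((segreGauss hd p).proj (segreFrame q none)) = 0 := by
    intro w
    rw [segreFrame, toHom_mfderiv_segreGauss hd p w (hspan none)]
    exact Gr.coproj_eq_zero _ (Submodule.sum_mem _ fun j _ => update_mem_segreTangent _ _ _)
  have hsome : ∀ (w : ∀ i, GrModel (EuclideanSpace ℝ (Fin (n i))) 1) i m, (segreGauss hd p).toHom
      (mfderiv (segreModel n) 𝓘(ℝ, GrModel (Tensor n) (segreDim n)) (segreGauss hd) p w)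
      ((segreGauss hd p).proj (segreFrame q (some ⟨i, m⟩))) = (segreGauss hd p).coproj
        (normalVelocity q w i ((q i).coframe (EuclideanSpace.single m 1))) := by
    intro w i m
    rw [segreFrame, toHom_mfderiv_segreGauss hd p w (hspan (some ⟨i, m⟩)), ← hq, normalVelocity,
      ← Finset.add_sum_erase _ _ (Finset.mem_univ i)]
    congr 1
    -- Slot `i` drops out because the nilpotent map kills the complement of the line.
    rw [Function.update_self, nilFactors_coframe]
    refine (congrArg (· + _) ((tensorProdL n).map_update_zero _ i)).trans ((zero_add _).trans ?_)
    refine Finset.sum_congr rfl fun j hj => ?_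
    rw [Function.update_of_ne (Finset.ne_of_mem_erase hj), nilFactors_rep]
  rw [hnone, inner_zero_left, zero_add]
  have hin : ∀ i m, ⟪(segreGauss hd p).toHom
      (mfderiv (segreModel n) 𝓘(ℝ, GrModel (Tensor n) (segreDim n)) (segreGauss hd) p u)
        ((segreGauss hd p).proj (segreFrame q (some ⟨i, m⟩))), (segreGauss hd p).toHom
      (mfderiv (segreModel n) 𝓘(ℝ, GrModel (Tensor n) (segreDim n)) (segreGauss hd) p v)
        ((segreGauss hd p).proj (segreFrame q (some ⟨i, m⟩)))⟫_ℝ =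
      ∑ j ∈ Finset.univ.erase i, (q j).fubiniStudy (u j) (v j) := by
    intro i m
    rw [hsome, hsome]
    refine ((segreGauss hd p).inner_coproj (normalVelocity_mem_orthogonal hd q u i _)).trans ?_
    refine inner_normalVelocity q u v i ?_
    rw [Gr.inner_coframe]
    simp
  -- The value does not depend on `m`, so the sum over `m` yields the factor `n i - 1`.
  simp only [hin, Finset.sum_const, Finset.card_univ, Fintype.card_fin, finrank_euclideanSpace_fin,
    nsmul_eq_mul]
  have herase : ∀ i, ∑ j ∈ Finset.univ.erase i, (q j).fubiniStudy (u j) (v j) =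
      ∑ j, (q j).fubiniStudy (u j) (v j) - (q i).fubiniStudy (u i) (v i) := fun i =>
    eq_sub_of_add_eq' (Finset.add_sum_erase _ (fun j => (q j).fubiniStudy (u j) (v j))
      (Finset.mem_univ i))
  simp only [herase, mul_sub, Finset.sum_sub_distrib]
  -- Collecting by factor, the coefficient at `i` is `∑ j, (n j - 1) - (n i - 1)`, which equals
  -- `segreDim n - n i`.
  rw [← Finset.sum_mul, Finset.mul_sum, ← Finset.sum_sub_distrib]
  refine Finset.sum_congr rfl fun i _ => ?_
  have h1 : ((n i - 1 : ℕ) : ℝ) = n i - 1 := by rw [Nat.cast_sub (hn i), Nat.cast_one]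
  have h2 : ((segreDim n : ℕ) : ℝ) = 1 + ∑ j, ((n j - 1 : ℕ) : ℝ) := by
    rw [segreDim]; push_cast; rfl
  rw [h2, h1]
  ring

theorem weightedMetric_eq_sum (p : ProjSegre n)
    (u v : ∀ i, GrModel (EuclideanSpace ℝ (Fin (n i))) 1) :
    weightedMetric n p u v =
      ∑ i, ((segreDim n : ℝ) - n i) * ((segreEquiv n).symm p i).fubiniStudy (u i) (v i) := by
  have h := fun w : ∀ i, GrModel (EuclideanSpace ℝ (Fin (n i))) 1 =>
    DFunLike.congr_fun (mfderiv_segreEquiv_symm p) w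
  exact congrArg₂ (weightedProdMetric n ((segreEquiv n).symm p)) (h u) (h v)

/-- The weighted metric is definite. -/
theorem eq_zero_of_weightedMetric_self (hn : ∀ i, 1 ≤ n i) (hw : ∀ i, 2 ≤ n i → n i < segreDim n)
    (p : ProjSegre n) (u : ∀ i, GrModel (EuclideanSpace ℝ (Fin (n i))) 1)
    (h : weightedMetric n p u u = 0) : u = 0 := by
  rw [weightedMetric_eq_sum, Finset.sum_eq_zero_iff_of_nonneg] at h
  · funext i
    have key : u i (EuclideanSpace.single 0 1) = 0 := by
      rcases (hn i).eq_or_lt with h1 | h1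
      -- For `n i = 1` the projective space is a point: the coordinates of its tangent space range
      -- over an empty index type.
      · ext m
        have hm := m.2
        have hf := finrank_euclideanSpace_fin (𝕜 := ℝ) (n := n i)
        omega
      · have hpos : (0 : ℝ) < segreDim n - n i := sub_pos.2 (by exact_mod_cast hw i h1)
        have h2 := (mul_eq_zero.1 (h i (Finset.mem_univ i))).resolve_left hpos.ne'
        exact inner_self_eq_zero.1 h2
    ext1 x
    have hx : x = x 0 • EuclideanSpace.single 0 1 := by
      ext j
      rw [Subsingleton.elim j 0]
      simp
    rw [hx, map_smul, key, smul_zero]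
    rfl
  · intro i _
    -- For `n i = 1` the weight is still nonnegative, since `segreDim n ≥ 1`.
    refine mul_nonneg (sub_nonneg.2 ?_) real_inner_self_nonneg
    rcases (hn i).eq_or_lt with h1 | h1
    · rw [← h1]
      exact_mod_cast Nat.le_add_right 1 _
    · exact_mod_cast (hw i h1).le

end Metric

end

theorem proposition4p1 {d : ℕ} (hd : 1 ≤ d) (n : Fin d → ℕ) (hn : ∀ i, 1 ≤ n i)
    (hw : ∀ i, 2 ≤ n i → n i < segreDim n) :
    ∃ φ : ProjSegre n → Gr (Tensor n) (segreDim n),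
      (∀ (A : Tensor n) (hA : A ∈ segre n),
        ((φ (ProjSegre.ofTensor A hA)).toSubmodule : Set (Tensor n)) =
          tangentVectors (segre n) A) ∧
      IsIsometricImmersion (segreModel n) 𝓘(ℝ, GrModel (Tensor n) (segreDim n))
        (weightedMetric n) Gr.standardMetric φ := by
  have hiso : ∀ p (u v : TangentSpace (segreModel n) p), weightedMetric n p u v =
      (segreGauss hd p).standardMetric
        (mfderiv (segreModel n) 𝓘(ℝ, GrModel (Tensor n) (segreDim n)) (segreGauss hd) p u)
        (mfderiv (segreModel n) 𝓘(ℝ, GrModel (Tensor n) (segreDim n)) (segreGauss hd) p v) :=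
    fun p u v => (weightedMetric_eq_sum p u v).trans
      (standardMetric_mfderiv_segreGauss hd hn p u v).symm
  refine ⟨segreGauss hd, tangentGr_segreEquiv_symm hd, contMDiff_segreGauss hd, fun p => ?_, hiso⟩
  -- A vector killed by the differential has weighted norm zero by the isometry, and the weighted
  -- metric is definite.
  refine (injective_iff_map_eq_zero _).2 fun u hu => ?_
  refine eq_zero_of_weightedMetric_self hn hw p u ?_
  rw [hiso, hu]
  exact (segreGauss hd p).standardMetric_zero_right 0
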